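/- Let $H$ be a separable real Hilbert space, let $(\Omega,\mathcal F,P)$ be a complete probability space, and let $Z\subset H$ be nonempty and closed, with distance function $d_Z$. Write $\mathfrak W(u_n)$ and $\mathfrak S(u_n)$ for the sets of weak and strong sequential cluster points of a sequence $(u_n)$ in $H$. Let $\mathfrak C$ be the class of functions $\varphi:\Omega\times H\to[0,\infty)$ such that $\varphi(\omega,\cdot)$ is continuous for almost every $\omega$, $\varphi(\cdot,z)$ is $\mathcal F$-measurable for every $z\in H$, and $\int_\Omega\varphi(\omega,y(\omega))\,P(d\omega)<\infty$ for every $y\in L^2(\Omega;H)$. **Algorithm.** Let $x_0\in L^2(\Omega;H)$. For $n=0,1,\dots$ put $\mathcal X_n=\sigma(x_0,\dots,x_n)$ and take $t_n^*\in L^2(\Omega;H)$, $\eta_n\in L^1(\Omega;\mathbb R)$, $\varepsilon_n\in\mathfrak C$ and $\lambda_n\in L^\infty(\Omega;(0,\infty))$ such that, with $$A_n=[t_n^*\ne0]\cap[\langle x_n,t_n^*\rangle>\eta_n],\qquad \alpha_n=\begin{cases}(\langle x_n,t_n^*\rangle-\eta_n)/\|t_n^*\|^2&\text{on }A_n,\\0&\text{elsewhere,}\end{cases}\qquad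 d_n=\alpha_nt_n^*,$$ the following hold: $1_{A_n}\eta_n/\|t_n^*\|$ (read as $0$ off $A_n$) is in $L^2(\Omega;\mathbb R)$; for every $z\in Z$, $\langle z,E(\alpha_nt_n^*\mid\mathcal X_n)\rangle\le E(\alpha_n\eta_n\mid\mathcal X_n)+\varepsilon_n(\cdot,z)$ a.s.; $\lambda_n$ is independent of $\sigma(x_0,\dots,x_n,d_n)$; and $E(\lambda_n(2-\lambda_n))\ge0$. Set $x_{n+1}=x_n-\lambda_nd_n$. **Theorem.** Let $(x_n)$ be a sequence generated by this algorithm. Then $x_n,d_n\in L^2(\Omega;H)$ for every $n$, and the following hold. (i) Suppose that, for every $z\in Z$, $\sum_n\varepsilon_n(\cdot,z)E\lambda_n<\infty$ a.s. Then: (a) $\sum_nE(\lambda_n(2-\lambda_n))\,E(\|d_n\|^2\mid\mathcal X_n)<\infty$ a.s. (b) If $\inf_nE(\lambda_n(2-\lambda_n))>0$ and there is $\rho\in[1,\infty)$ with $\sup_n\lambda_n<\rho$ a.s., then $\sum_nE(\|x_{n+1}-x_n\|^2\mid\mathcal X_n)<\infty$ a.s. and $\sum_n\|x_{n+1}-x_n\|^2<\infty$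 a.s. (c) If $\mathfrak W(x_n)\subset Z$ a.s., then $(x_n)$ converges weakly a.s. to a $Z$-valued random variable. (d) If $\mathfrak S(x_n)\cap Z\ne\varnothing$ a.s., then $(x_n)$ converges strongly a.s. to a $Z$-valued random variable. (e) If $\mathfrak S(x_n)\neq\varnothing$ a.s. and $\mathfrak W(x_n)\subset Z$ a.s., then $(x_n)$ converges strongly a.s. to a $Z$-valued random variable. (ii) Suppose that, for every $z\in Z$, $\sum_nE\varepsilon_n(\cdot,z)\,E\lambda_n<\infty$. Then: (a) $\sum_nE(\lambda_n(2-\lambda_n))\,E\|d_n\|^2<\infty$. (b) If $\inf_nE(\lambda_n(2-\lambda_n))>0$ and there is $\rho\in[1,\infty)$ with $\sup_n\lambda_n<\rho$ a.s., then $\sum_nE\|x_{n+1}-x_n\|^2<\infty$. (c) If $\mathfrak W(x_n)\subset Z$ a.s., then $(x_n)$ converges weakly a.s. and weakly in $L^2(\Omega;H)$ to some $x\in L^2(\Omega;Z)$. (d) If $\mathfrak S(x_n)\cap Z\ne\varnothing$ a.s., then $(x_n)$ converges strongly a.s., strongly in $L^1(\Omega;H)$, and weakly in $L^2(\Omega;H)$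 to some $x\in L^2(\Omega;Z)$. (e) If $Z$ is convex, every $\varepsilon_n$ is constant in its $H$-variable, and $\liminf_nE\,d_Z^2(x_n)=0$, then $(x_n)$ converges strongly in $L^2(\Omega;H)$ and strongly a.s. to a $Z$-valued random variable. (f) Suppose that $Z$ is convex, that every $\varepsilon_n$ is constant in its $H$-variable, and put $\vartheta_n=\varepsilon_n(\cdot,0)$. Suppose that there is $\chi\in(0,1)$ with $E(d_Z^2(x_{n+1})\mid\mathcal X_n)\le\chi d_Z^2(x_n)+2\vartheta_nE\lambda_n$ a.s. for every $n$. Then: [A] for every $n$, $E\,d_Z^2(x_{n+1})\le\chi^{n+1}E\,d_Z^2(x_0)+2\sum_{j=0}^n\chi^{n-j}E\vartheta_j\,E\lambda_j$; [B] there is $x\in L^2(\Omega;Z)$ such that $(x_n)$ converges to $x$ strongly in $L^2(\Omega;H)$ and strongly a.s., and, for every $n$, $$E\|x_n-x\|^2\le4\chi^nE\,d_Z^2(x_0)+8\sum_{j=0}^{n-1}\chi^{n-j-1}E\vartheta_j\,E\lambda_j+4\sum_{j\ge n}E\vartheta_j\,E\lambda_j.$$ -/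

import Mathlib

open MeasureTheory ProbabilityTheory Filter Topology Set TopologicalSpace

/-- Weak convergence of a sequence in a real normed space (Mathlib's weak topology). -/
def WeakTendsto {E : Type*} [NormedAddCommGroup E] [NormedSpace ℝ E] (u : ℕ → E) (a : E) : Prop :=
  Tendsto (fun n => toWeakSpace ℝ E (u n)) atTop (𝓝 (toWeakSpace ℝ E a))

/-- The set of weak sequential cluster points of a sequence. -/
def weakClusterPts {E : Type*} [NormedAddCommGroup E] [NormedSpace ℝ E] (u : ℕ → E) : Set E :=
  {a | ∃ k : ℕ → ℕ, StrictMono k ∧ WeakTendsto (fun n => u (k n)) a}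

/-- The set of strong sequential cluster points of a sequence. -/
def strongClusterPts {E : Type*} [NormedAddCommGroup E] (u : ℕ → E) : Set E :=
  {a | ∃ k : ℕ → ℕ, StrictMono k ∧ Tendsto (fun n => u (k n)) atTop (𝓝 a)}

/-- An `S`-valued random variable. -/
def IsRandomVariableIn {Ω H : Type*} [MeasurableSpace Ω] [MeasurableSpace H]
    (S : Set H) (x : Ω → H) : Prop :=
  Measurable x ∧ ∀ ω, x ω ∈ S

/-- `x` represents an element of `L²(Ω, F, P; S)`. -/
def IsL2In {Ω H : Type*} [MeasurableSpace Ω] [NormedAddCommGroup H] [MeasurableSpace H]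
    (P : Measure Ω) (S : Set H) (x : Ω → H) : Prop :=
  Measurable x ∧ MemLp x 2 P ∧ ∀ᵐ ω ∂P, x ω ∈ S

/-- Almost sure weak convergence. -/
def WeakTendstoAS {Ω H : Type*} [MeasurableSpace Ω] [NormedAddCommGroup H] [NormedSpace ℝ H]
    (P : Measure Ω) (x : ℕ → Ω → H) (y : Ω → H) : Prop :=
  ∀ᵐ ω ∂P, WeakTendsto (fun n => x n ω) (y ω)

/-- Almost sure strong convergence. -/
def StrongTendstoAS {Ω H : Type*} [MeasurableSpace Ω] [NormedAddCommGroup H]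
    (P : Measure Ω) (x : ℕ → Ω → H) (y : Ω → H) : Prop :=
  ∀ᵐ ω ∂P, Tendsto (fun n => x n ω) atTop (𝓝 (y ω))

/-- Weak convergence in the Hilbert space `L²(Ω, F, P; H)`; membership of all terms and of the
limit is part of the claim. -/
def WeakTendstoL2 {Ω H : Type*} [MeasurableSpace Ω] [NormedAddCommGroup H] [NormedSpace ℝ H]
    (P : Measure Ω) (x : ℕ → Ω → H) (y : Ω → H) : Prop :=
  ∃ (hx : ∀ n, MemLp (x n) 2 P) (hy : MemLp y 2 P),
    WeakTendsto (fun n => (hx n).toLp (x n)) (hy.toLp y)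

/-- Strong convergence in `L^p(Ω, F, P; H)`; membership of all terms and of the limit is part of
the claim. -/
def StrongTendstoLp {Ω H : Type*} [MeasurableSpace Ω] [NormedAddCommGroup H]
    (P : Measure Ω) (p : ENNReal) (x : ℕ → Ω → H) (y : Ω → H) : Prop :=
  (∀ n, MemLp (x n) p P) ∧ MemLp y p P ∧
    Tendsto (fun n => eLpNorm (fun ω => x n ω - y ω) p P) atTop (𝓝 0)

/-- The σ-algebra generated by `x 0, …, x n`. -/
@[reducible] def pastSigma {Ω H : Type*} [MeasurableSpace H] (x : ℕ → Ω → H) (n : ℕ) : MeasurableSpace Ω :=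
  ⨆ k : ℕ, ⨆ _ : k ≤ n, MeasurableSpace.comap (x k) inferInstance

/-- The class of Carathéodory integrands `φ : Ω × H → [0, ∞)` such that `φ(·, x)` has a finite
integral for every `x` in `L²(Ω, F, P; H)`. -/
structure IsCaratheodoryL2 {Ω H : Type*} [MeasurableSpace Ω] [NormedAddCommGroup H]
    (P : Measure Ω) (φ : Ω → H → ℝ) : Prop where
  nonneg : ∀ ω z, 0 ≤ φ ω z
  continuous : ∀ᵐ ω ∂P, Continuous (φ ω)
  measurable : ∀ z, Measurable (fun ω => φ ω z)
  integral_lt_top : ∀ x : Ω → H, MemLp x 2 P → ∫⁻ ω, ENNReal.ofReal (φ ω (x ω)) ∂P < ⊤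

/-- The event on which a genuine step is made: `t* ≠ 0` and `⟨x, t*⟩ > η`. -/
def activeSet {Ω H : Type*} [NormedAddCommGroup H] [InnerProductSpace ℝ H]
    (x t : Ω → H) (η : Ω → ℝ) : Set Ω :=
  {ω | t ω ≠ 0} ∩ {ω | η ω < inner ℝ (x ω) (t ω)}

/-- The coefficient `α`: equal to `(⟨x, t*⟩ - η) / ‖t*‖²` on the active set and to `0` elsewhere. -/
noncomputable def stepCoeff {Ω H : Type*} [NormedAddCommGroup H] [InnerProductSpace ℝ H]
    (x t : Ω → H) (η : Ω → ℝ) : Ω → ℝ :=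
  (activeSet x t η).indicator (fun ω => (inner ℝ (x ω) (t ω) - η ω) / ‖t ω‖ ^ 2)

/-- The direction `d = α t*`. -/
noncomputable def stepDir {Ω H : Type*} [NormedAddCommGroup H] [InnerProductSpace ℝ H]
    (x t : Ω → H) (η : Ω → ℝ) : Ω → H :=
  fun ω => stepCoeff x t η ω • t ω

/-- `x` is a sequence produced by the stochastic geometric algorithm for the target set `Z`, with
the choices `t` (for `t*`), `η`, `ε` (tolerances) and `lam` (relaxations). Random variables are
represented by measurable functions, and the update holds almost surely. -/
structure IsGeometricIteration {Ω H : Type*} [MeasurableSpace Ω]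
    [NormedAddCommGroup H] [InnerProductSpace ℝ H] [CompleteSpace H] [MeasurableSpace H]
    (P : Measure Ω) (Z : Set H) (x t : ℕ → Ω → H) (η : ℕ → Ω → ℝ)
    (ε : ℕ → Ω → H → ℝ) (lam : ℕ → Ω → ℝ) : Prop where
  measurable_x : ∀ n, Measurable (x n)
  memLp_zero : MemLp (x 0) 2 P
  measurable_t : ∀ n, Measurable (t n)
  memLp_t : ∀ n, MemLp (t n) 2 P
  measurable_eta : ∀ n, Measurable (η n)
  integrable_eta : ∀ n, Integrable (η n) P
  memLp_eta_div : ∀ n,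
    MemLp ((activeSet (x n) (t n) (η n)).indicator (fun ω => η n ω / ‖t n ω‖)) 2 P
  integrable_eps : ∀ n, ∀ z ∈ Z, Integrable (fun ω => ε n ω z) P
  eps_nonneg : ∀ n, ∀ z ∈ Z, ∀ᵐ ω ∂P, 0 ≤ ε n ω z
  outer_approx : ∀ n, ∀ z ∈ Z, ∀ᵐ ω ∂P,
    inner ℝ z ((P[fun ω' => stepCoeff (x n) (t n) (η n) ω' • t n ω' | pastSigma x n]) ω) ≤
      (P[fun ω' => stepCoeff (x n) (t n) (η n) ω' * η n ω' | pastSigma x n]) ω + ε n ω z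
  measurable_lam : ∀ n, Measurable (lam n)
  memLp_lam : ∀ n, MemLp (lam n) ⊤ P
  lam_pos : ∀ n, ∀ᵐ ω ∂P, 0 < lam n ω
  update : ∀ n, ∀ᵐ ω ∂P, x (n + 1) ω = x n ω - lam n ω • stepDir (x n) (t n) (η n) ω

/-- The geometric algorithm with super relaxations: the tolerances are Carathéodory integrands,
`lam n` is independent of `σ(x 0, …, x n, d n)`, and `E(lam n (2 - lam n)) ≥ 0`. -/
structure IsSuperRelaxedIteration {Ω H : Type*} [MeasurableSpace Ω]
    [NormedAddCommGroup H] [InnerProductSpace ℝ H] [CompleteSpace H] [MeasurableSpace H]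
    (P : Measure Ω) (Z : Set H) (x t : ℕ → Ω → H) (η : ℕ → Ω → ℝ)
    (ε : ℕ → Ω → H → ℝ) (lam : ℕ → Ω → ℝ) : Prop
    extends IsGeometricIteration P Z x t η ε lam where
  eps_caratheodory : ∀ n, IsCaratheodoryL2 P (ε n)
  indep : ∀ n, Indep (MeasurableSpace.comap (lam n) inferInstance)
    (pastSigma x n ⊔ MeasurableSpace.comap (stepDir (x n) (t n) (η n)) inferInstance) P
  relax : ∀ n, 0 ≤ ∫ ω, lam n ω * (2 - lam n ω) ∂P

/-! ### Sequences whose distances to points converge -/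

section Distances

variable {H : Type*} [NormedAddCommGroup H]

/-! Everything rests on one inequality. Since `⟨xₙ, dₙ⟩ = ‖dₙ‖² + αₙηₙ`, expanding `‖xₙ - λₙdₙ -
z‖²`, conditioning on the past and pulling out `λₙ` and `λₙ²` as means by independence gives
`E(‖xₙ₊₁ - z‖² | 𝒳ₙ) ≤ ‖xₙ - z‖² - E(λₙ(2 - λₙ)) E(‖dₙ‖² | 𝒳ₙ) + 2 εₙ Eλₙ`
(`condExp_norm_relaxed_step_sub_sq_le`). Only the mean of `λₙ(2 - λₙ)` enters, so `λₙ` may exceed 2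
on some events.

If the errors are a.s. summable, Robbins–Siegmund
(`ae_summable_and_tendsto_of_almost_supermartingale`) makes the decreases summable and `‖xₙ - z‖`
convergent a.s. for each `z ∈ Z`; separability gives one null set for all `z`. Opial's lemma then
yields weak convergence, and a strong cluster point in `Z` forces its limiting distance to be 0.

If the expected errors are summable, the integrated inequality bounds `(xₙ)` in `L²`. Fatou places
the limit in `L²`, and a Vitali argument turns a.s. convergence into convergence in `L¹` or weakly
in `L²`.

If the tolerances do not depend on the point, the inequality also holds for an `𝒳ₙ`-measurable
random point of `Z`. Taking the projection of `xₙ` gives `E‖xₙ₊ₖ - xₙ‖² ≤ 4 E d_Z²(xₙ) + 4 ∑_{j ≥ n}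
Eεⱼ Eλⱼ`. Hence `(xₙ)` is Cauchy in `L²` once `E d_Z²(xₙ)` is small along a subsequence, and `k → ∞`
gives the rate. -/

theorem norm_bounded_of_tendsto_norm_sub {u : ℕ → H} {z : H} {l : ℝ}
    (h : Tendsto (fun n => ‖u n - z‖) atTop (𝓝 l)) : ∃ r, ∀ n, ‖u n‖ ≤ r := by
  obtain ⟨B, hB⟩ := h.bddAbove_range
  refine ⟨B + ‖z‖, fun n => ?_⟩
  have h1 : ‖u n - z‖ ≤ B := hB ⟨n, rfl⟩
  have h2 : ‖u n‖ ≤ ‖u n - z‖ + ‖z‖ := by simpa using norm_add_le (u n - z) z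
  linarith

theorem tendsto_of_strongClusterPts_of_tendsto_norm_sub {u : ℕ → H} {z : H} {l : ℝ}
    (hl : Tendsto (fun n => ‖u n - z‖) atTop (𝓝 l)) (hz : z ∈ strongClusterPts u) :
    Tendsto u atTop (𝓝 z) := by
  obtain ⟨k, hk, h⟩ := hz
  have h0 : Tendsto (fun n => ‖u (k n) - z‖) atTop (𝓝 0) := tendsto_iff_norm_sub_tendsto_zero.1 h
  have : l = 0 := tendsto_nhds_unique (hl.comp hk.tendsto_atTop) h0
  subst this
  exact tendsto_iff_norm_sub_tendsto_zero.2 hl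

/-- Needed because almost sure statements can be intersected only over countably many points. The
bound `|‖u n - z‖ - ‖u n - w‖| ≤ ‖z - w‖`, uniform in `n`, transfers the Cauchy property. -/
theorem tendsto_norm_sub_of_dense {u : ℕ → H} {Z D : Set H} (hDZ : Z ⊆ closure D)
    (hd : ∀ z ∈ D, ∃ l, Tendsto (fun n => ‖u n - z‖) atTop (𝓝 l)) :
    ∀ z ∈ Z, ∃ l, Tendsto (fun n => ‖u n - z‖) atTop (𝓝 l) := by
  intro z hz
  refine cauchySeq_tendsto_of_complete (Metric.cauchySeq_iff.2 fun δ hδ => ?_)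
  obtain ⟨w, hw, hzw⟩ := Metric.mem_closure_iff.1 (hDZ hz) (δ / 3) (by positivity)
  obtain ⟨l, hl⟩ := hd w hw
  obtain ⟨N, hN⟩ := Metric.cauchySeq_iff.1 hl.cauchySeq (δ / 3) (by positivity)
  have hbd : ∀ n, |‖u n - z‖ - ‖u n - w‖| ≤ dist z w := fun n => by
    refine (abs_norm_sub_norm_le _ _).trans ?_
    rw [sub_sub_sub_cancel_left, dist_comm, dist_eq_norm]
  refine ⟨N, fun m hm n hn => ?_⟩
  have h1 := hN m hm n hn
  have h2 := abs_le.1 (hbd m)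
  have h3 := abs_le.1 (hbd n)
  rw [Real.dist_eq, abs_lt] at h1 ⊢
  constructor <;> linarith [h1.1, h1.2, h2.1, h2.2, h3.1, h3.2]

end Distances

/-! ### Weak convergence and Opial's lemma in a Hilbert space -/

section Pathwise

variable {H : Type*} [NormedAddCommGroup H] [InnerProductSpace ℝ H]

theorem weakTendsto_iff_inner [CompleteSpace H] {u : ℕ → H} {a : H} :
    WeakTendsto u a ↔ ∀ e : H, Tendsto (fun n => inner ℝ e (u n)) atTop (𝓝 (inner ℝ e a)) := by
  have hinj : Function.Injective (topDualPairing ℝ H).flip := by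
    intro p q hpq
    refine ext_inner_left ℝ fun e => ?_
    have := LinearMap.congr_fun hpq (InnerProductSpace.toDual ℝ H e)
    simpa [topDualPairing] using this
  unfold WeakTendsto
  have key := WeakBilin.tendsto_iff_forall_eval_tendsto (l := atTop)
    (f := fun n => toWeakSpace ℝ H (u n)) (x := toWeakSpace ℝ H a) (topDualPairing ℝ H).flip hinj
  refine key.trans ⟨fun h e => h (InnerProductSpace.toDual ℝ H e), fun h φ => ?_⟩
  obtain ⟨e, rfl⟩ := (InnerProductSpace.toDual ℝ H).surjective φ
  exact h e

/-- Sequential Banach–Alaoglu in the dual of a separable space, carried back by the Riesz isometry.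
-/
theorem exists_weakTendsto_subseq [CompleteSpace H] [SeparableSpace H] {u : ℕ → H} {r : ℝ}
    (hu : ∀ n, ‖u n‖ ≤ r) : ∃ (a : H) (k : ℕ → ℕ), StrictMono k ∧
      WeakTendsto (fun n => u (k n)) a := by
  have hs := WeakDual.isSeqCompact_closedBall ℝ H 0 r
  have hmem : ∀ n, StrongDual.toWeakDual (InnerProductSpace.toDual ℝ H (u n)) ∈
      WeakDual.toStrongDual ⁻¹' Metric.closedBall (0 : StrongDual ℝ H) r := by
    intro n
    simpa using hu n
  obtain ⟨φ, -, k, hk, hlim⟩ := hs hmem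
  refine ⟨(InnerProductSpace.toDual ℝ H).symm (WeakDual.toStrongDual φ), k, hk, ?_⟩
  rw [weakTendsto_iff_inner]
  intro e
  have h := (tendsto_iff_forall_eval_tendsto_topDualPairing.1 hlim) e
  have h1 : topDualPairing ℝ H φ e =
      inner ℝ e ((InnerProductSpace.toDual ℝ H).symm (WeakDual.toStrongDual φ)) := by
    rw [real_inner_comm, InnerProductSpace.toDual_symm_apply]
    rfl
  rw [h1] at h
  refine h.congr fun n => ?_
  rw [real_inner_comm]
  rfl

theorem Filter.Tendsto.weakTendsto {u : ℕ → H} {a : H} (h : Tendsto u atTop (𝓝 a)) :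
    WeakTendsto u a :=
  ((toWeakSpaceCLM ℝ H).continuous.tendsto a).comp h

theorem strongClusterPts_subset_weakClusterPts (u : ℕ → H) :
    strongClusterPts u ⊆ weakClusterPts u :=
  fun _ ⟨k, hk, h⟩ => ⟨k, hk, h.weakTendsto⟩

/-- Opial's lemma: a sequence whose distances to all points of `Z` converge and whose weak cluster
points all lie in `Z` converges weakly to a point of `Z`. -/
theorem exists_weakTendsto_of_opial [CompleteSpace H] [SeparableSpace H] {u : ℕ → H} {Z : Set H}
    (hZ : Z.Nonempty) (hd : ∀ z ∈ Z, ∃ l, Tendsto (fun n => ‖u n - z‖) atTop (𝓝 l))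
    (hw : weakClusterPts u ⊆ Z) : ∃ y ∈ Z, WeakTendsto u y := by
  obtain ⟨z, hz⟩ := hZ
  obtain ⟨l, hl⟩ := hd z hz
  obtain ⟨r, hr⟩ := norm_bounded_of_tendsto_norm_sub hl
  obtain ⟨a, k, hk, ha⟩ := exists_weakTendsto_subseq hr
  have haZ : a ∈ Z := hw ⟨k, hk, ha⟩
  have huniq : ∀ b ∈ weakClusterPts u, b = a := by
    rintro b ⟨j, hj, hb⟩
    have hbZ : b ∈ Z := hw ⟨j, hj, hb⟩
    obtain ⟨la, hla⟩ := hd a haZ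
    obtain ⟨lb, hlb⟩ := hd b hbZ
    -- `2⟨a - b, u n⟩ = ‖u n - b‖² - ‖u n - a‖² + ‖a‖² - ‖b‖²`, so this inner product converges
    -- along the whole sequence. Its limits along the two subsequences agree, hence `⟨a - b, a - b⟩
    -- = 0`.
    have hconv : Tendsto (fun n => inner ℝ (a - b) (u n)) atTop
        (𝓝 ((lb ^ 2 - la ^ 2 + ‖a‖ ^ 2 - ‖b‖ ^ 2) / 2)) := by
      refine (((((hlb.pow 2).sub (hla.pow 2)).add_const (‖a‖ ^ 2)).sub_const
        (‖b‖ ^ 2)).div_const 2).congr fun n => ?_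
      rw [norm_sub_sq_real, norm_sub_sq_real, inner_sub_left, real_inner_comm a, real_inner_comm b]
      ring
    have h1 := tendsto_nhds_unique (hconv.comp hk.tendsto_atTop)
      (weakTendsto_iff_inner.1 ha (a - b))
    have h2 := tendsto_nhds_unique (hconv.comp hj.tendsto_atTop)
      (weakTendsto_iff_inner.1 hb (a - b))
    have h3 : inner ℝ (a - b) (a - b) = (0 : ℝ) := by
      rw [inner_sub_right, ← h1, ← h2, sub_self]
    exact (sub_eq_zero.1 (inner_self_eq_zero.1 h3)).symm
  refine ⟨a, haZ, weakTendsto_iff_inner.2 fun e => ?_⟩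
  refine tendsto_of_subseq_tendsto fun ns hns => ?_
  obtain ⟨b, m, hm, hb⟩ := exists_weakTendsto_subseq (u := fun n => u (ns n)) fun n => hr (ns n)
  obtain ⟨p, hp, hnp⟩ := strictMono_subseq_of_tendsto_atTop (hns.comp hm.tendsto_atTop)
  have hb' : WeakTendsto (fun n => u ((ns ∘ m ∘ p) n)) b :=
    hb.comp hp.tendsto_atTop
  have hba : b = a := huniq b ⟨ns ∘ m ∘ p, hnp, hb'⟩
  subst hba
  exact ⟨m, weakTendsto_iff_inner.1 hb e⟩

/-- From `‖u n‖² ≥ 2⟨a, u n⟩ - ‖a‖²`, whose right side tends to `‖a‖²`. The extended-valued form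
feeds Fatou's lemma. -/
theorem WeakTendsto.norm_sq_le_liminf [CompleteSpace H] {u : ℕ → H} {a : H}
    (h : WeakTendsto u a) :
    ENNReal.ofReal (‖a‖ ^ 2) ≤ liminf (fun n => ENNReal.ofReal (‖u n‖ ^ 2)) atTop := by
  have h1 : Tendsto (fun n => 2 * inner ℝ a (u n) - ‖a‖ ^ 2) atTop (𝓝 (‖a‖ ^ 2)) := by
    have h2 := ((weakTendsto_iff_inner.1 h a).const_mul 2).sub_const (‖a‖ ^ 2)
    rw [real_inner_self_eq_norm_sq] at h2
    convert! h2 using 2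
    ring
  rw [← ((ENNReal.continuous_ofReal.tendsto _).comp h1).liminf_eq]
  refine liminf_le_liminf (Eventually.of_forall fun n => ENNReal.ofReal_le_ofReal ?_)
  have h3 : 0 ≤ ‖a - u n‖ ^ 2 := sq_nonneg _
  rw [norm_sub_sq_real] at h3
  linarith

end Pathwise

/-! ### Metric projection onto a closed convex set -/

section Projection

variable {H : Type*} [NormedAddCommGroup H] [InnerProductSpace ℝ H]

/-- The metric projection onto a nonempty closed convex set is nonexpansive. -/
theorem exists_nonexpansive_projection [CompleteSpace H] {Z : Set H} (hne : Z.Nonempty)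
    (hcl : IsClosed Z) (hconv : Convex ℝ Z) :
    ∃ p : H → H, (∀ u, p u ∈ Z) ∧ (∀ u, ‖u - p u‖ = Metric.infDist u Z) ∧ LipschitzWith 1 p := by
  choose p hp hmin using exists_norm_eq_iInf_of_complete_convex hne hcl.isComplete hconv
  refine ⟨p, hp, fun u => ?_, LipschitzWith.of_dist_le_mul fun u v => ?_⟩
  · rw [hmin, Metric.infDist_eq_iInf]
    simp_rw [dist_eq_norm]
  · have h1 := (norm_eq_iInf_iff_real_inner_le_zero hconv (hp u)).1 (hmin u) (p v) (hp v)
    have h2 := (norm_eq_iInf_iff_real_inner_le_zero hconv (hp v)).1 (hmin v) (p u) (hp u)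
    -- Adding the two variational inequalities gives firm nonexpansiveness; Cauchy–Schwarz then
    -- gives the Lipschitz bound.
    have h3 : ‖p u - p v‖ ^ 2 ≤ inner ℝ (u - v) (p u - p v) := by
      rw [← real_inner_self_eq_norm_sq]
      have e1 : inner ℝ (u - p u) (p v - p u) = - inner ℝ (u - p u) (p u - p v) := by
        rw [← inner_neg_right, neg_sub]
      have e2 : inner ℝ (u - v) (p u - p v) = inner ℝ (u - p u) (p u - p v)
          + inner ℝ (p u - p v) (p u - p v) - inner ℝ (v - p v) (p u - p v) := by
        rw [← inner_add_left, ← inner_sub_left]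
        congr 1
        abel
      linarith
    have h4 := h3.trans (real_inner_le_norm _ _)
    rw [NNReal.coe_one, one_mul, dist_eq_norm, dist_eq_norm]
    rcases (norm_nonneg (p u - p v)).eq_or_lt with h0 | h0
    · rw [← h0]; positivity
    · exact le_of_mul_le_mul_right (by nlinarith) h0

end Projection

/-! ### Measurability of weak and strong limits -/

section Measurability

variable {Ω H : Type*} [MeasurableSpace Ω] [NormedAddCommGroup H] [InnerProductSpace ℝ H]
  [SeparableSpace H] [MeasurableSpace H] [BorelSpace H]

/-- Pettis' argument: a distance is a countable supremum of inner products with normalized vectors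
of a dense sequence, and every open set is a countable union of balls. -/
theorem measurable_of_measurable_inner {y : Ω → H}
    (h : ∀ e : H, Measurable fun ω => inner ℝ e (y ω)) : Measurable y := by
  have hdist : ∀ a : H, Measurable fun ω => dist (y ω) a := by
    intro a
    -- In `ENNReal` the supremum needs no boundedness, and truncating negative inner products to 0
    -- is harmless. A zero vector of the dense sequence contributes 0.
    have heq : (fun ω => ENNReal.ofReal (dist (y ω) a)) =
        fun ω => ⨆ n, ENNReal.ofReal
          (inner ℝ (‖denseSeq H n‖⁻¹ • denseSeq H n) (y ω - a)) := by
      funext ω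
      apply le_antisymm
      · rw [dist_eq_norm]
        rcases eq_or_ne (y ω - a) 0 with h0 | h0
        · simp [h0]
        have hpos : 0 < ‖y ω - a‖ := norm_pos_iff.2 h0
        have hcont : ContinuousAt (fun e : H => ENNReal.ofReal (inner ℝ (‖e‖⁻¹ • e) (y ω - a)))
            (y ω - a) := by
          refine ENNReal.continuous_ofReal.continuousAt.comp ?_
          have : ContinuousAt (fun e : H => ‖e‖⁻¹ • e) (y ω - a) :=
            (continuous_norm.continuousAt.inv₀ hpos.ne').smul continuousAt_id
          exact this.inner continuousAt_const
        have hval : ‖y ω - a‖ = inner ℝ (‖y ω - a‖⁻¹ • (y ω - a)) (y ω - a) := by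
          rw [real_inner_smul_left, real_inner_self_eq_norm_sq, pow_two,
            inv_mul_cancel_left₀ hpos.ne']
        rw [hval]
        refine le_of_forall_lt fun c hc => ?_
        obtain ⟨n, hn⟩ := (denseRange_denseSeq H).exists_mem_open
          (s := interior {e : H | c < ENNReal.ofReal (inner ℝ (‖e‖⁻¹ • e) (y ω - a))})
          isOpen_interior ⟨_, mem_interior_iff_mem_nhds.2 (hcont.eventually (lt_mem_nhds hc))⟩
        have hn' := interior_subset hn
        rw [mem_ofPred_eq] at hn'
        exact lt_of_lt_of_le hn' (le_iSup (fun n => ENNReal.ofReal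
          (inner ℝ (‖denseSeq H n‖⁻¹ • denseSeq H n) (y ω - a))) n)
      · refine iSup_le fun n => ENNReal.ofReal_le_ofReal ?_
        rw [dist_eq_norm]
        refine (real_inner_le_norm _ _).trans ?_
        rw [norm_smul, norm_inv, norm_norm]
        exact mul_le_of_le_one_left (norm_nonneg _) inv_mul_le_one
    have hm : Measurable fun ω => ENNReal.ofReal (dist (y ω) a) := by
      rw [heq]
      refine Measurable.iSup fun n => ENNReal.measurable_ofReal.comp ?_
      simp_rw [inner_sub_right]
      exact (h _).sub_const _
    simpa only [ENNReal.toReal_ofReal dist_nonneg] using hm.ennreal_toReal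
  refine measurable_of_isOpen fun s hs => ?_
  have hcov : s = ⋃ i ∈ {i : ℕ × ℕ | Metric.ball (denseSeq H i.1) (1 / ((i.2 : ℝ) + 1)) ⊆ s},
      Metric.ball (denseSeq H i.1) (1 / ((i.2 : ℝ) + 1)) := by
    apply subset_antisymm
    · intro a ha
      obtain ⟨δ, hδ, hball⟩ := Metric.isOpen_iff.1 hs a ha
      obtain ⟨m, hm⟩ := exists_nat_one_div_lt (half_pos hδ)
      obtain ⟨n, hn⟩ := (denseRange_denseSeq H).exists_dist_lt a
        (show (0 : ℝ) < 1 / ((m : ℝ) + 1) by positivity)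
      refine mem_iUnion₂.2 ⟨(n, m), fun b hb => hball ?_, hn⟩
      rw [Metric.mem_ball] at hb ⊢
      have := dist_triangle b (denseSeq H n) a
      rw [dist_comm] at hn
      linarith
    · exact iUnion₂_subset fun i hi => hi
  rw [hcov, preimage_iUnion₂]
  exact MeasurableSet.biUnion (to_countable _) fun i _ =>
    measurableSet_lt (hdist _) measurable_const

variable [CompleteSpace H] {P : Measure Ω}

/-- A sequence of random variables that a.s. converges weakly to a point of `Z` has a `Z`-valued
random variable as its a.s. weak limit. -/
theorem exists_randomVariable_weakLimit {Z : Set H} (hZ : Z.Nonempty) {x : ℕ → Ω → H}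
    (hx : ∀ n, Measurable (x n)) (h : ∀ᵐ ω ∂P, ∃ y ∈ Z, WeakTendsto (fun n => x n ω) y) :
    ∃ y : Ω → H, IsRandomVariableIn Z y ∧ WeakTendstoAS P x y := by
  classical
  obtain ⟨z, hz⟩ := hZ
  obtain ⟨N, hsub, hNm, hN0⟩ := exists_measurable_superset_of_null (ae_iff.1 h)
  have hgood : ∀ ω, ω ∉ N → ∃ y ∈ Z, WeakTendsto (fun n => x n ω) y := fun ω hω => by
    by_contra hc
    exact hω (hsub hc)
  choose! f hfZ hf using hgood
  -- Resetting to a fixed `z ∈ Z` on the measurable null set `N` makes the limit `Z`-valued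
  -- everywhere, and the equally modified sequence converges weakly at every `ω`.
  refine ⟨fun ω => if ω ∈ N then z else f ω, ⟨?_, fun ω => ?_⟩, ?_⟩
  · refine measurable_of_measurable_inner fun e => ?_
    refine measurable_of_tendsto_metrizable
      (f := fun n ω => inner ℝ e (if ω ∈ N then z else x n ω)) (fun n => ?_) ?_
    · exact (innerSL ℝ e).continuous.measurable.comp
        (Measurable.ite hNm measurable_const (hx n))
    · rw [tendsto_pi_nhds]
      intro ω
      by_cases hω : ω ∈ N
      · simp [hω]
      · simpa [hω] using weakTendsto_iff_inner.1 (hf ω hω) e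
  · by_cases hω : ω ∈ N
    · simpa [hω] using hz
    · simpa [hω] using hfZ ω hω
  · have : ∀ᵐ ω ∂P, ω ∉ N := by rw [ae_iff]; simpa using hN0
    filter_upwards [this] with ω hω
    simpa [hω] using hf ω hω

/-- Measurability comes from the weak version; uniqueness of weak limits identifies the two limits.
-/
theorem exists_randomVariable_strongLimit {Z : Set H} (hZ : Z.Nonempty) {x : ℕ → Ω → H}
    (hx : ∀ n, Measurable (x n)) (h : ∀ᵐ ω ∂P, ∃ y ∈ Z, Tendsto (fun n => x n ω) atTop (𝓝 y)) :
    ∃ y : Ω → H, IsRandomVariableIn Z y ∧ StrongTendstoAS P x y := by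
  obtain ⟨y, hy, hlim⟩ := exists_randomVariable_weakLimit (P := P) hZ hx
    (h.mono fun ω ⟨y, hyZ, hy⟩ => ⟨y, hyZ, hy.weakTendsto⟩)
  refine ⟨y, hy, ?_⟩
  filter_upwards [h, hlim] with ω ⟨w, _, hw⟩ hyω
  have : w = y ω := ext_inner_left ℝ fun e => tendsto_nhds_unique
    (weakTendsto_iff_inner.1 hw.weakTendsto e) (weakTendsto_iff_inner.1 hyω e)
  rwa [← this]

end Measurability

/-! ### Almost supermartingales -/

section RobbinsSiegmund

variable {Ω : Type*} {m0 : MeasurableSpace Ω} {μ : Measure Ω} [IsFiniteMeasure μ]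

/-- The Robbins–Siegmund theorem with adapted errors, for the process stopped when the accumulated
errors exceed `a`. -/
theorem ae_tendsto_stopped_almost_supermartingale (ℱ : Filtration ℕ m0) {V θ ζ : ℕ → Ω → ℝ}
    (hVm : ∀ n, StronglyMeasurable[ℱ n] (V n)) (hVi : ∀ n, Integrable (V n) μ)
    (hV0 : ∀ n, ∀ᵐ ω ∂μ, 0 ≤ V n ω)
    (hθm : ∀ n, StronglyMeasurable[ℱ n] (θ n)) (hθi : ∀ n, Integrable (θ n) μ)
    (hθ0 : ∀ n, ∀ᵐ ω ∂μ, 0 ≤ θ n ω)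
    (hζm : ∀ n, StronglyMeasurable[ℱ n] (ζ n)) (hζi : ∀ n, Integrable (ζ n) μ)
    (hζ0 : ∀ n ω, 0 ≤ ζ n ω)
    (h : ∀ n, ∀ᵐ ω ∂μ, (μ[V (n + 1) | ℱ n]) ω ≤ V n ω - θ n ω + ζ n ω) {a : ℝ} (ha : 0 ≤ a) :
    ∀ᵐ ω ∂μ, (∀ n, ∑ k ∈ Finset.range n, ζ k ω ≤ a) →
      ∃ l, Tendsto (fun n => V n ω + ∑ k ∈ Finset.range n, (θ k ω - ζ k ω)) atTop (𝓝 l) := by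
  -- `A (n + 1)` involves only `ζ 0, …, ζ n`, so it is already known at time `n`: the cutoff is
  -- predictable.
  set A : ℕ → Set Ω := fun n => {ω | ∑ k ∈ Finset.range n, ζ k ω ≤ a} with hA
  have hAm : ∀ n, MeasurableSet[ℱ n] (A (n + 1)) := fun n => by
    have : StronglyMeasurable[ℱ n] (fun ω => ∑ k ∈ Finset.range (n + 1), ζ k ω) :=
      Finset.stronglyMeasurable_fun_sum _ fun k hk =>
        (hζm k).mono (ℱ.mono (Nat.lt_succ_iff.1 (Finset.mem_range.1 hk)))
    exact this.measurable measurableSet_Iic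
  have hA0 : A 0 = univ := by simp [hA, ha]
  have hAm' : ∀ n, MeasurableSet[ℱ n] (A n) := fun n => by
    cases n with
    | zero => rw [hA0]; exact MeasurableSet.univ
    | succ n => exact ℱ.mono n.le_succ _ (hAm n)
  have hAanti : ∀ n, A (n + 1) ⊆ A n := fun n ω hω => by
    simp only [hA, mem_ofPred_eq, Finset.sum_range_succ] at hω ⊢
    linarith [hζ0 n ω]
  set B : ℕ → Ω → ℝ := fun n ω =>
    ∑ k ∈ Finset.range n, (A (k + 1)).indicator (fun ω => θ k ω - ζ k ω) ω with hB
  -- `V` is killed once the error budget `a` is spent, and only increments within the budget are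
  -- counted. This makes `Y` a supermartingale bounded below by `-a`. Where the budget is never
  -- spent, nothing is cut off.
  set Y : ℕ → Ω → ℝ := fun n => (A n).indicator (V n) + B n with hY
  have hBm : ∀ n, StronglyMeasurable[ℱ n] (B (n + 1)) := fun n =>
    Finset.stronglyMeasurable_fun_sum _ fun k hk => by
      have hk' := Nat.lt_succ_iff.1 (Finset.mem_range.1 hk)
      exact (((hθm k).sub (hζm k)).indicator (hAm k)).mono (ℱ.mono hk')
  have hBm' : ∀ n, StronglyMeasurable[ℱ n] (B n) := fun n => by
    cases n with
    | zero => simpa [hB] using stronglyMeasurable_const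
    | succ n => exact (hBm n).mono (ℱ.mono n.le_succ)
  have hBi : ∀ n, Integrable (B n) μ := fun n => integrable_finsetSum _ fun k _ =>
    ((hθi k).sub (hζi k)).indicator (ℱ.le k _ (hAm k))
  have hYi : ∀ n, Integrable (Y n) μ := fun n =>
    ((hVi n).indicator (ℱ.le n _ (hAm' n))).add (hBi n)
  have hsup : Supermartingale Y ℱ μ := by
    refine supermartingale_nat (fun n => ((hVm n).indicator (hAm' n)).add (hBm' n)) hYi fun n => ?_
    have e1 : μ[Y (n + 1) | ℱ n] =ᵐ[μ] μ[(A (n + 1)).indicator (V (n + 1)) | ℱ n] +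
        μ[B (n + 1) | ℱ n] :=
      condExp_add ((hVi _).indicator (ℱ.le n _ (hAm n))) (hBi _) _
    rw [condExp_of_stronglyMeasurable (ℱ.le n) (hBm n) (hBi _)] at e1
    have e2 := condExp_indicator (μ := μ) (hVi (n + 1)) (hAm n)
    filter_upwards [e1, e2, h n, hV0 n] with ω h1 h2 h3 h4
    rw [h1, Pi.add_apply, h2]
    have h5 : B (n + 1) ω =
        B n ω + (A (n + 1)).indicator (fun ω => θ n ω - ζ n ω) ω := Finset.sum_range_succ _ _
    simp only [hY, Pi.add_apply, h5]
    by_cases hω : ω ∈ A (n + 1)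
    · simp only [indicator_of_mem hω, indicator_of_mem (hAanti n hω)]
      linarith
    -- Off `A (n + 1)` the only change is the loss of the nonnegative term `V n`.
    · simp only [indicator_of_notMem hω]
      have := indicator_apply_nonneg (s := A n) (f := V n) (a := ω) fun _ => h4
      linarith
  have hlow : ∀ n, ∀ᵐ ω ∂μ, -a ≤ Y n ω := fun n => by
    filter_upwards [hV0 n, ae_all_iff.2 hθ0] with ω h1 h2
    have hsum : ∀ n, ∑ k ∈ Finset.range n, (A (k + 1)).indicator (ζ k) ω ≤ a ∧
        ∑ k ∈ Finset.range n, (A (k + 1)).indicator (ζ k) ω ≤ ∑ k ∈ Finset.range n, ζ k ω := by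
      intro n
      induction n with
      | zero => simpa using ha
      | succ n ih =>
        rw [Finset.sum_range_succ, Finset.sum_range_succ]
        by_cases hω : ω ∈ A (n + 1)
        · rw [indicator_of_mem hω]
          have hω' := hω
          simp only [hA, mem_ofPred_eq, Finset.sum_range_succ] at hω'
          constructor <;> linarith [ih.2]
        · rw [indicator_of_notMem hω]
          constructor <;> linarith [ih.1, ih.2, hζ0 n ω]
    have hBlow : -a ≤ B n ω := by
      have h3 : -∑ k ∈ Finset.range n, (A (k + 1)).indicator (ζ k) ω ≤ B n ω := by
        rw [← Finset.sum_neg_distrib]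
        refine Finset.sum_le_sum fun k _ => ?_
        by_cases hω : ω ∈ A (k + 1)
        · simp only [indicator_of_mem hω]
          linarith [h2 k]
        · simp only [indicator_of_notMem hω, neg_zero, le_refl]
      linarith [(hsum n).1]
    have := indicator_apply_nonneg (s := A n) (f := V n) (a := ω) fun _ => h1
    simp only [hY, Pi.add_apply]
    linarith
  have hbdd : ∀ n, eLpNorm ((-Y) n) 1 μ ≤
      ((∫ ω, Y 0 ω ∂μ + 2 * a * μ.real univ).toNNReal : ENNReal) := fun n => by
    rw [Pi.neg_apply, eLpNorm_neg, eLpNorm_one_eq_lintegral_enorm,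
      ← ofReal_integral_norm_eq_lintegral_enorm (hYi n)]
    refine ENNReal.ofReal_le_ofReal ?_
    -- `|Y n| ≤ Y n + 2a` because `Y n ≥ -a`.
    have h1 : ∫ ω, ‖Y n ω‖ ∂μ ≤ ∫ ω, (Y n ω + 2 * a) ∂μ := by
      refine integral_mono_ae (hYi n).norm ((hYi n).add (integrable_const _)) ?_
      filter_upwards [hlow n] with ω hω
      rw [Real.norm_eq_abs, abs_le]
      constructor <;> linarith
    rw [integral_add (hYi n) (integrable_const _), integral_const, smul_eq_mul] at h1
    have h2 : ∫ ω, Y n ω ∂μ ≤ ∫ ω, Y 0 ω ∂μ := by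
      have := hsup.setIntegral_le (Nat.zero_le n) (s := univ) MeasurableSet.univ
      simpa using this
    linarith
  filter_upwards [hsup.neg.ae_tendsto_limitProcess hbdd] with ω hω hall
  refine ⟨_, hω.neg.congr fun n => ?_⟩
  have hmem : ∀ n, ω ∈ A n := hall
  simp [hY, hB, hmem]

/-- The Robbins–Siegmund theorem. The errors `ξ` need not be adapted. -/
theorem ae_summable_and_tendsto_of_almost_supermartingale (ℱ : Filtration ℕ m0)
    {V θ ξ : ℕ → Ω → ℝ}
    (hVm : ∀ n, StronglyMeasurable[ℱ n] (V n)) (hVi : ∀ n, Integrable (V n) μ)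
    (hV0 : ∀ n, ∀ᵐ ω ∂μ, 0 ≤ V n ω)
    (hθm : ∀ n, StronglyMeasurable[ℱ n] (θ n)) (hθi : ∀ n, Integrable (θ n) μ)
    (hθ0 : ∀ n, ∀ᵐ ω ∂μ, 0 ≤ θ n ω)
    (hξ0 : ∀ n, ∀ᵐ ω ∂μ, 0 ≤ ξ n ω) (hξ : ∀ᵐ ω ∂μ, Summable fun n => ξ n ω)
    (h : ∀ n, ∀ᵐ ω ∂μ, (μ[V (n + 1) | ℱ n]) ω ≤ V n ω - θ n ω + ξ n ω) :
    ∀ᵐ ω ∂μ, (Summable fun n => θ n ω) ∧ ∃ l, Tendsto (fun n => V n ω) atTop (𝓝 l) := by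
  -- The positive part of the actual drift is adapted and a.s. at most `ξ n`, so it can replace the
  -- non-adapted error.
  set ζ : ℕ → Ω → ℝ := fun n ω => max ((μ[V (n + 1) | ℱ n]) ω - V n ω + θ n ω) 0 with hζ
  have hζm : ∀ n, StronglyMeasurable[ℱ n] (ζ n) := fun n =>
    have hm : StronglyMeasurable[ℱ n] fun ω => (μ[V (n + 1) | ℱ n]) ω - V n ω + θ n ω :=
      (stronglyMeasurable_condExp.sub (hVm n)).add (hθm n)
    (continuous_id.max continuous_const).comp_stronglyMeasurable hm
  have hζi : ∀ n, Integrable (ζ n) μ := fun n =>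
    ((integrable_condExp.sub (hVi n)).add (hθi n)).sup (integrable_zero _ _ _)
  have hζ0 : ∀ n ω, 0 ≤ ζ n ω := fun n ω => le_max_right _ _
  -- Integer budgets keep the union of exceptional sets null; each summable path fits within one of
  -- them.
  have hmain : ∀ a : ℕ, ∀ᵐ ω ∂μ, (∀ n, ∑ k ∈ Finset.range n, ζ k ω ≤ (a : ℝ)) →
      ∃ l, Tendsto (fun n => V n ω + ∑ k ∈ Finset.range n, (θ k ω - ζ k ω)) atTop (𝓝 l) :=
    fun a => ae_tendsto_stopped_almost_supermartingale ℱ hVm hVi hV0 hθm hθi hθ0 hζm hζi hζ0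
      (fun n => Eventually.of_forall fun ω => by
        have := le_max_left ((μ[V (n + 1) | ℱ n]) ω - V n ω + θ n ω) 0
        simp only [hζ]
        linarith) a.cast_nonneg
  filter_upwards [ae_all_iff.2 hmain, hξ, ae_all_iff.2 hξ0, ae_all_iff.2 h, ae_all_iff.2 hV0,
    ae_all_iff.2 hθ0] with ω h1 h2 h3 h4 h5 h6
  have hs : Summable fun n => ζ n ω := by
    refine Summable.of_nonneg_of_le (fun n => hζ0 n ω) (fun n => ?_) h2
    exact max_le (by linarith [h4 n]) (h3 n)
  obtain ⟨a, ha⟩ := exists_nat_ge (∑' n, ζ n ω)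
  obtain ⟨l, hl⟩ := h1 a fun n => (hs.sum_le_tsum _ fun k _ => hζ0 k ω).trans ha
  have hVθ : Tendsto (fun n => V n ω + ∑ k ∈ Finset.range n, θ k ω) atTop
      (𝓝 (l + ∑' n, ζ n ω)) := by
    refine (hl.add hs.hasSum.tendsto_sum_nat).congr fun n => ?_
    rw [Finset.sum_sub_distrib]
    ring
  have hsθ : Summable fun n => θ n ω := by
    obtain ⟨C, hC⟩ := hVθ.bddAbove_range
    refine summable_of_sum_range_le (c := C) h6 fun n => ?_
    have := hC ⟨n, rfl⟩
    simp only at this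
    linarith [h5 n]
  refine ⟨hsθ, _, (hVθ.sub hsθ.hasSum.tendsto_sum_nat).congr fun n => ?_⟩
  ring

/-- If the conditional expectations of an adapted nonnegative sequence are a.s. summable, then so
is the sequence. -/
theorem ae_summable_of_ae_summable_condExp (ℱ : Filtration ℕ m0) {U : ℕ → Ω → ℝ}
    (hUm : ∀ n, StronglyMeasurable[ℱ (n + 1)] (U n)) (hUi : ∀ n, Integrable (U n) μ)
    (hU0 : ∀ n ω, 0 ≤ U n ω) (h : ∀ᵐ ω ∂μ, Summable fun n => (μ[U n | ℱ n]) ω) :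
    ∀ᵐ ω ∂μ, Summable fun n => U n ω := by
  have hVm : ∀ n, StronglyMeasurable[ℱ n] (fun ω => ∑ k ∈ Finset.range n, U k ω) := fun n =>
    Finset.stronglyMeasurable_fun_sum _ fun k hk =>
      (hUm k).mono (ℱ.mono (Nat.succ_le_of_lt (Finset.mem_range.1 hk)))
  have hVi : ∀ n, Integrable (fun ω => ∑ k ∈ Finset.range n, U k ω) μ := fun n =>
    integrable_finsetSum _ fun k _ => hUi k
  -- The partial sums form the process and their conditional increments are the errors, so the
  -- partial sums converge.
  have hrs := ae_summable_and_tendsto_of_almost_supermartingale (μ := μ) ℱ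
    (V := fun n ω => ∑ k ∈ Finset.range n, U k ω) (θ := fun _ _ => 0)
    (ξ := fun n => μ[U n | ℱ n]) hVm hVi
    (fun n => Eventually.of_forall fun ω => Finset.sum_nonneg fun k _ => hU0 k ω)
    (fun n => stronglyMeasurable_const) (fun n => integrable_zero _ _ _)
    (fun n => Eventually.of_forall fun ω => le_rfl)
    (fun n => condExp_nonneg (Eventually.of_forall (hU0 n))) h ?_
  · filter_upwards [hrs] with ω ⟨_, l, hl⟩
    obtain ⟨C, hC⟩ := hl.bddAbove_range
    exact summable_of_sum_range_le (fun n => hU0 n ω) fun n => hC ⟨n, rfl⟩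
  · intro n
    have e0 : (fun ω => ∑ k ∈ Finset.range (n + 1), U k ω) =
        (fun ω => ∑ k ∈ Finset.range n, U k ω) + U n := by
      funext ω
      exact Finset.sum_range_succ _ _
    have e1 := condExp_add (hVi n) (hUi n) (ℱ n)
    rw [condExp_of_stronglyMeasurable (ℱ.le n) (hVm n) (hVi n)] at e1
    simp only [e0]
    filter_upwards [e1] with ω hω
    rw [hω]
    simp

end RobbinsSiegmund

/-! ### Square-integrable sequences and a Vitali criterion -/

section SquareIntegrable

variable {Ω H : Type*} [MeasurableSpace Ω] [NormedAddCommGroup H] {P : Measure Ω}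

theorem MeasureTheory.MemLp.eLpNorm_two_eq {f : Ω → H} (hf : MemLp f 2 P) :
    eLpNorm f 2 P = ENNReal.ofReal (√(∫ ω, ‖f ω‖ ^ 2 ∂P)) := by
  rw [hf.eLpNorm_eq_integral_rpow_norm two_ne_zero ENNReal.ofNat_ne_top, Real.sqrt_eq_rpow]
  simp

theorem tendsto_eLpNorm_two_iff {f : ℕ → Ω → H} (hf : ∀ n, MemLp (f n) 2 P) :
    Tendsto (fun n => eLpNorm (f n) 2 P) atTop (𝓝 0) ↔
      Tendsto (fun n => ∫ ω, ‖f n ω‖ ^ 2 ∂P) atTop (𝓝 0) := by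
  simp_rw [fun n => (hf n).eLpNorm_two_eq]
  constructor
  · intro h
    have h1 := ((ENNReal.tendsto_toReal ENNReal.zero_ne_top).comp h).pow 2
    refine Tendsto.congr (fun n => ?_) (by simpa [Function.comp_def] using h1)
    rw [Real.sq_sqrt (integral_nonneg fun ω => sq_nonneg _)]
  · intro h
    have h1 := (ENNReal.continuous_ofReal.tendsto _).comp
      ((Real.continuous_sqrt.tendsto _).comp h)
    simpa [Function.comp_def] using h1

/-- Vitali-type criterion: products of an `L²`-bounded sequence with a fixed `L²` function that
tend to `0` a.s. tend to `0` in `L¹`. -/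
theorem tendsto_eLpNorm_one_of_le_mul [IsFiniteMeasure P] {E F : Type*} [NormedAddCommGroup E]
    [NormedAddCommGroup F] {u : ℕ → Ω → E} {a : ℕ → Ω → H} {b : Ω → F} {C : ℝ}
    (hu : ∀ n, AEStronglyMeasurable (u n) P) (ha : ∀ n, MemLp (a n) 2 P)
    (haC : ∀ n, ∫ ω, ‖a n ω‖ ^ 2 ∂P ≤ C) (hb : MemLp b 2 P)
    (hle : ∀ n, ∀ᵐ ω ∂P, ‖u n ω‖ ≤ ‖a n ω‖ * ‖b ω‖)
    (hlim : ∀ᵐ ω ∂P, Tendsto (fun n => u n ω) atTop (𝓝 0)) :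
    Tendsto (fun n => eLpNorm (u n) 1 P) atTop (𝓝 0) := by
  -- Over a set `s`, Cauchy–Schwarz bounds the mass by `‖a n‖₂ ‖1_s b‖₂`, and the single function
  -- `b` is uniformly integrable. The `+ 1` below keeps the divisor positive.
  have hui : UnifIntegrable u 1 P := by
    intro δ hδ
    have hpos : 0 < √C + 1 := by positivity
    obtain ⟨r, hr, hs⟩ := hb.eLpNorm_indicator_le one_le_two ENNReal.ofNat_ne_top
      (div_pos hδ hpos)
    refine ⟨r, hr, fun n s hsm hsr => ?_⟩
    have h1 : eLpNorm (s.indicator (u n)) 1 P ≤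
        eLpNorm (fun ω => ‖a n ω‖ * ‖s.indicator b ω‖) 1 P := by
      refine eLpNorm_mono_ae ?_
      filter_upwards [hle n] with ω hω
      by_cases hmem : ω ∈ s
      · simpa [hmem] using hω
      · simp [hmem]
    have h2 : eLpNorm (fun ω => ‖a n ω‖ * ‖s.indicator b ω‖) 1 P ≤
        eLpNorm (a n) 2 P * eLpNorm (s.indicator b) 2 P := by
      have := eLpNorm_smul_le_mul_eLpNorm (p := 2) (q := 2) (r := 1)
        (hb.indicator hsm).norm.1 (ha n).norm.1
      simp only [eLpNorm_norm] at this
      exact this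
    have h3 : eLpNorm (a n) 2 P ≤ ENNReal.ofReal (√C + 1) := by
      rw [(ha n).eLpNorm_two_eq]
      exact ENNReal.ofReal_le_ofReal ((Real.sqrt_le_sqrt (haC n)).trans (by linarith))
    refine h1.trans (h2.trans ((mul_le_mul' h3 (hs s hsm hsr)).trans ?_))
    rw [← ENNReal.ofReal_mul hpos.le, mul_div_cancel₀ _ hpos.ne']
  have := tendsto_Lp_finite_of_tendsto_ae (g := fun _ => (0 : E)) le_rfl ENNReal.one_ne_top hu
    MemLp.zero hui hlim
  refine this.congr fun n => ?_
  congr 1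
  funext ω
  simp

theorem MeasureTheory.MemLp.integrable_norm_sq {f : Ω → H} (hf : MemLp f 2 P) :
    Integrable (fun ω => ‖f ω‖ ^ 2) P :=
  hf.norm.integrable_sq

theorem integral_norm_add_sq_le {f g : Ω → H} (hf : MemLp f 2 P) (hg : MemLp g 2 P) :
    ∫ ω, ‖f ω + g ω‖ ^ 2 ∂P ≤ 2 * ∫ ω, ‖f ω‖ ^ 2 ∂P + 2 * ∫ ω, ‖g ω‖ ^ 2 ∂P := by
  rw [← integral_const_mul, ← integral_const_mul,
    ← integral_add (hf.integrable_norm_sq.const_mul 2) (hg.integrable_norm_sq.const_mul 2)]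
  refine integral_mono (hf.add hg).integrable_norm_sq
    ((hf.integrable_norm_sq.const_mul 2).add (hg.integrable_norm_sq.const_mul 2)) fun ω => ?_
  have h := pow_le_pow_left₀ (norm_nonneg _) (norm_add_le (f ω) (g ω)) 2
  simp only at h ⊢
  nlinarith [sq_nonneg (‖f ω‖ - ‖g ω‖)]

theorem exists_tendsto_of_cauchy_integral_norm_sq [CompleteSpace H] {x : ℕ → Ω → H}
    (hx : ∀ n, MemLp (x n) 2 P)
    (hC : ∀ δ > 0, ∃ N, ∀ n ≥ N, ∫ ω, ‖x n ω - x N ω‖ ^ 2 ∂P ≤ δ) :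
    ∃ y, MemLp y 2 P ∧ Tendsto (fun n => eLpNorm (fun ω => x n ω - y ω) 2 P) atTop (𝓝 0) := by
  have hcau : CauchySeq fun n => (hx n).toLp (x n) := by
    refine Metric.cauchySeq_iff'.2 fun δ hδ => ?_
    obtain ⟨N, hN⟩ := hC ((δ / 2) ^ 2) (by positivity)
    refine ⟨N, fun n hn => ?_⟩
    have hsub := (hx n).sub (hx N)
    rw [dist_eq_norm, ← MemLp.toLp_sub, Lp.norm_toLp, hsub.eLpNorm_two_eq,
      ENNReal.toReal_ofReal (Real.sqrt_nonneg _)]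
    calc √(∫ ω, ‖(x n - x N) ω‖ ^ 2 ∂P) ≤ √((δ / 2) ^ 2) := Real.sqrt_le_sqrt (hN n hn)
      _ = δ / 2 := Real.sqrt_sq (by positivity)
      _ < δ := half_lt_self hδ
  obtain ⟨g, hg⟩ := cauchySeq_tendsto_of_complete hcau
  refine ⟨g, Lp.memLp g, ?_⟩
  exact (Lp.tendsto_Lp_iff_tendsto_eLpNorm'' x hx g (Lp.memLp g)).1 (by simpa using hg)

theorem strongTendstoLp_one_of_strongTendstoAS [IsFiniteMeasure P] {x : ℕ → Ω → H} {y : Ω → H}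
    {C : ℝ} (hx : ∀ n, MemLp (x n) 2 P) (hy : MemLp y 2 P)
    (hC : ∀ n, ∫ ω, ‖x n ω‖ ^ 2 ∂P ≤ C) (h : StrongTendstoAS P x y) :
    StrongTendstoLp P 1 x y := by
  have hsub : ∀ n, MemLp (fun ω => x n ω - y ω) 2 P := fun n => (hx n).sub hy
  refine ⟨fun n => (hx n).mono_exponent one_le_two, hy.mono_exponent one_le_two, ?_⟩
  refine tendsto_eLpNorm_one_of_le_mul (P := P) (b := fun _ => (1 : ℝ))
    (C := 2 * C + 2 * ∫ ω, ‖y ω‖ ^ 2 ∂P) (fun n => (hsub n).1) hsub (fun n => ?_)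
    (memLp_const 1) (fun n => Eventually.of_forall fun ω => by simp) ?_
  · have := integral_norm_add_sq_le (hx n) hy.neg
    simp only [Pi.neg_apply, norm_neg, ← sub_eq_add_neg] at this
    linarith [hC n]
  · filter_upwards [h] with ω hω
    simpa using hω.sub_const (y ω)

end SquareIntegrable

/-! ### Passage from almost sure weak limits to `L²` -/

section WeakLimits

variable {Ω H : Type*} [MeasurableSpace Ω] [NormedAddCommGroup H] [InnerProductSpace ℝ H]
  [CompleteSpace H] {P : Measure Ω}

/-- Fatou's lemma for a.s. weak limits of `L²`-bounded sequences. -/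
theorem memLp_and_integral_norm_sq_le_of_weakTendstoAS {x : ℕ → Ω → H} {y : Ω → H} {C : ℝ}
    (hx : ∀ n, MemLp (x n) 2 P) (hy : AEStronglyMeasurable y P)
    (hC : ∀ n, ∫ ω, ‖x n ω‖ ^ 2 ∂P ≤ C) (h : WeakTendstoAS P x y) :
    MemLp y 2 P ∧ ∫ ω, ‖y ω‖ ^ 2 ∂P ≤ C := by
  have hC0 : 0 ≤ C := (integral_nonneg fun ω => sq_nonneg _).trans (hC 0)
  have hF : ∫⁻ ω, ENNReal.ofReal (‖y ω‖ ^ 2) ∂P ≤ ENNReal.ofReal C := by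
    calc ∫⁻ ω, ENNReal.ofReal (‖y ω‖ ^ 2) ∂P
        ≤ ∫⁻ ω, liminf (fun n => ENNReal.ofReal (‖x n ω‖ ^ 2)) atTop ∂P :=
          lintegral_mono_ae (h.mono fun ω hω => hω.norm_sq_le_liminf)
      _ ≤ liminf (fun n => ∫⁻ ω, ENNReal.ofReal (‖x n ω‖ ^ 2) ∂P) atTop :=
          lintegral_liminf_le' fun n =>
            ((hx n).1.norm.aemeasurable.pow_const 2).ennreal_ofReal
      _ ≤ liminf (fun _ : ℕ => ENNReal.ofReal C) atTop := by
          refine liminf_le_liminf (Eventually.of_forall fun n => ?_)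
          rw [← ofReal_integral_eq_lintegral_ofReal (hx n).integrable_norm_sq
            (Eventually.of_forall fun ω => sq_nonneg _)]
          exact ENNReal.ofReal_le_ofReal (hC n)
      _ = ENNReal.ofReal C := by simp
  have hint : Integrable (fun ω => ‖y ω‖ ^ 2) P := by
    refine ⟨hy.norm.pow 2, ?_⟩
    rw [hasFiniteIntegral_iff_ofReal (Eventually.of_forall fun ω => sq_nonneg _)]
    exact hF.trans_lt ENNReal.ofReal_lt_top
  refine ⟨(memLp_two_iff_integrable_sq_norm hy).2 hint, ?_⟩
  rw [← ofReal_integral_eq_lintegral_ofReal hint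
    (Eventually.of_forall fun ω => sq_nonneg _)] at hF
  exact (ENNReal.ofReal_le_ofReal_iff hC0).1 hF

/-- For fixed `g ∈ L²`, `⟨g, x n - y⟩` tends to 0 a.s. and is at most `‖x n - y‖ ‖g‖`, so the Vitali
criterion applies with `b = g`. -/
theorem weakTendstoL2_of_weakTendstoAS [IsFiniteMeasure P] {x : ℕ → Ω → H} {y : Ω → H} {C : ℝ}
    (hx : ∀ n, MemLp (x n) 2 P) (hy : MemLp y 2 P)
    (hC : ∀ n, ∫ ω, ‖x n ω‖ ^ 2 ∂P ≤ C) (h : WeakTendstoAS P x y) : WeakTendstoL2 P x y := by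
  refine ⟨hx, hy, weakTendsto_iff_inner.2 fun g => ?_⟩
  have hsub : ∀ n, MemLp (fun ω => x n ω - y ω) 2 P := fun n => (hx n).sub hy
  have hbd : ∀ n, ∫ ω, ‖x n ω - y ω‖ ^ 2 ∂P ≤ 2 * C + 2 * ∫ ω, ‖y ω‖ ^ 2 ∂P := fun n => by
    have := integral_norm_add_sq_le (hx n) hy.neg
    simp only [Pi.neg_apply, norm_neg, ← sub_eq_add_neg] at this
    linarith [hC n]
  have hg := Lp.memLp g
  have hmeas : ∀ n, AEStronglyMeasurable (fun ω => (inner ℝ (g ω) (x n ω - y ω) : ℝ)) P :=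
    fun n => hg.1.inner (hsub n).1
  have hlim := tendsto_eLpNorm_one_of_le_mul (P := P)
    (u := fun n ω => (inner ℝ (g ω) (x n ω - y ω) : ℝ)) (b := fun ω => g ω) hmeas hsub hbd hg
    (fun n => Eventually.of_forall fun ω => by
      rw [mul_comm]; exact norm_inner_le_norm _ _)
    (by
      filter_upwards [h] with ω hω
      have := (weakTendsto_iff_inner.1 hω (g ω)).sub_const (inner ℝ (g ω) (y ω))
      simpa only [inner_sub_right, sub_self] using this)
  have hint : ∀ n, Integrable (fun ω => (inner ℝ (g ω) (x n ω - y ω) : ℝ)) P := fun n =>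
    (L2.integrable_inner g ((hsub n).toLp _)).congr (by
      filter_upwards [(hsub n).coeFn_toLp] with ω hω
      rw [hω])
  have heq : ∀ n, inner ℝ g ((hx n).toLp (x n)) - inner ℝ g (hy.toLp y) =
      ∫ ω, (inner ℝ (g ω) (x n ω - y ω) : ℝ) ∂P := fun n => by
    rw [← inner_sub_right, ← MemLp.toLp_sub, L2.inner_def]
    refine integral_congr_ae ?_
    filter_upwards [((hx n).sub hy).coeFn_toLp] with ω hω
    rw [hω, Pi.sub_apply]
  rw [tendsto_iff_norm_sub_tendsto_zero]
  have h0 := (ENNReal.tendsto_toReal ENNReal.zero_ne_top).comp hlim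
  refine squeeze_zero (fun n => norm_nonneg _) (fun n => ?_) (by simpa using h0)
  rw [heq, Function.comp_apply, eLpNorm_one_eq_lintegral_enorm,
    ← ofReal_integral_norm_eq_lintegral_enorm (hint n),
    ENNReal.toReal_ofReal (integral_nonneg fun ω => norm_nonneg _)]
  exact norm_integral_le_integral_norm _

end WeakLimits

/-! ### Conditional decrease of the squared distance -/

section CondExpIndep

/-- A factor independent of the conditioning data pulls out of a conditional expectation as its
mean. -/
theorem condExp_mul_of_indep {Ω : Type*} {mf m m' m0 : MeasurableSpace Ω} {P : Measure[m0] Ω}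
    [IsFiniteMeasure P] (hmm : m ≤ m') (hm' : m' ≤ m0) (hmf : mf ≤ m0) (hind : Indep mf m' P)
    {f g : Ω → ℝ} (hf : StronglyMeasurable[mf] f) (hg : StronglyMeasurable[m'] g)
    (hfi : Integrable f P) (hfg : Integrable (f * g) P) :
    P[f * g | m] =ᵐ[P] fun ω => (∫ ω', f ω' ∂P) * (P[g | m]) ω := by
  -- Conditioning first on the larger `m'` makes `g` known and averages `f`; the tower property then
  -- descends to `m`.
  have h1 : P[f * g | m'] =ᵐ[P] (∫ ω', f ω' ∂P) • g := by
    filter_upwards [condExp_mul_of_stronglyMeasurable_right hg hfg hfi,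
      condExp_indep_eq hmf hm' hf hind] with ω h1 h2
    rw [h1, Pi.mul_apply, h2]
    rfl
  have h2 : P[f * g | m] =ᵐ[P] P[(∫ ω', f ω' ∂P) • g | m] :=
    (condExp_condExp_of_le hmm hm').symm.trans (condExp_congr_ae h1)
  exact h2.trans (condExp_smul _ _ _)

end CondExpIndep

section RelaxedStep

variable {Ω H : Type*} {m m' mΩ : MeasurableSpace Ω} [NormedAddCommGroup H]
  [InnerProductSpace ℝ H]

theorem MeasureTheory.MemLp.integrable_real_inner {P : Measure Ω} {f g : Ω → H}
    (hf : MemLp f 2 P) (hg : MemLp g 2 P) :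
    Integrable (fun ω => (inner ℝ (f ω) (g ω) : ℝ)) P :=
  (hf.norm.integrable_mul hg.norm).mono (hf.1.inner hg.1)
    (Eventually.of_forall fun _ => (norm_inner_le_norm _ _).trans (le_abs_self _))

theorem integral_mul_two_sub {P : Measure Ω} [IsFiniteMeasure P] {l : Ω → ℝ} (hl : MemLp l ⊤ P) :
    ∫ ω, l ω * (2 - l ω) ∂P = 2 * ∫ ω, l ω ∂P - ∫ ω, (l * l) ω ∂P := by
  rw [← integral_const_mul, ← integral_sub ((hl.integrable le_top).const_mul 2)
    ((hl.mul (p := ⊤) (r := ⊤) hl).integrable le_top)]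
  refine integral_congr_ae (Eventually.of_forall fun ω => ?_)
  simp only [Pi.mul_apply]
  ring

/-- The conditional decrease of the squared distance to `z` in a step with direction `d` and an
independent relaxation `l`. -/
theorem condExp_norm_relaxed_step_sub_sq_le [CompleteSpace H] [SecondCountableTopology H]
    [MeasurableSpace H] [BorelSpace H] {P : Measure Ω} [IsProbabilityMeasure P]
    (hmm : m ≤ m') (hm' : m' ≤ mΩ) {x z d : Ω → H} {A e l : Ω → ℝ}
    (hx : Measurable[m] x) (hz : Measurable[m] z) (hd : Measurable[m'] d)
    (hx2 : MemLp x 2 P) (hz2 : MemLp z 2 P) (hd2 : MemLp d 2 P) (hA : Integrable A P)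
    (hxd : ∀ ω, inner ℝ (x ω) (d ω) = ‖d ω‖ ^ 2 + A ω)
    (hlm : Measurable l) (hl : MemLp l ⊤ P) (hl0 : 0 ≤ ∫ ω, l ω ∂P)
    (hind : Indep (MeasurableSpace.comap l inferInstance) m' P)
    (hze : ∀ᵐ ω ∂P, inner ℝ (z ω) ((P[d | m]) ω) ≤ (P[A | m]) ω + e ω) :
    ∀ᵐ ω ∂P, (P[fun ω' => ‖x ω' - l ω' • d ω' - z ω'‖ ^ 2 | m]) ω ≤
      ‖x ω - z ω‖ ^ 2 - (∫ ω', l ω' * (2 - l ω') ∂P) * (P[fun ω' => ‖d ω'‖ ^ 2 | m]) ω +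
      2 * (∫ ω', l ω' ∂P) * e ω := by
  set U : Ω → ℝ := fun ω => inner ℝ (z ω - x ω) (d ω) with hU
  set W : Ω → ℝ := fun ω => ‖d ω‖ ^ 2 with hW
  have hUm : StronglyMeasurable[m'] U :=
    ((hz.mono hmm le_rfl).sub (hx.mono hmm le_rfl)).stronglyMeasurable.inner
      hd.stronglyMeasurable
  have hWm : StronglyMeasurable[m'] W := hd.stronglyMeasurable.norm.pow 2
  have hUi : Integrable U P := (hz2.sub hx2).integrable_real_inner hd2
  have hWi : Integrable W P := hd2.integrable_norm_sq
  have hll : MemLp (l * l) ⊤ P := hl.mul (p := ⊤) (r := ⊤) hl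
  have hlU : Integrable (l * U) P :=
    memLp_one_iff_integrable.1 ((memLp_one_iff_integrable.2 hUi).mul (p := ⊤) hl)
  have hlW : Integrable (l * l * W) P :=
    memLp_one_iff_integrable.1 ((memLp_one_iff_integrable.2 hWi).mul (p := ⊤) hll)
  have hdec : (fun ω => ‖x ω - l ω • d ω - z ω‖ ^ 2) =
      (fun ω => ‖x ω - z ω‖ ^ 2) + ((2 : ℝ) • (l * U) + l * l * W) := by
    funext ω
    have : x ω - l ω • d ω - z ω = (x ω - z ω) - l ω • d ω := by abel
    simp only [this, norm_sub_sq_real, hU, hW, Pi.add_apply, Pi.smul_apply, Pi.mul_apply,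
      inner_smul_right, norm_smul, mul_pow, Real.norm_eq_abs, sq_abs, smul_eq_mul]
    rw [← neg_sub (x ω) (z ω), inner_neg_left]
    ring
  have hVm : StronglyMeasurable[m] (fun ω => ‖x ω - z ω‖ ^ 2) :=
    (hx.sub hz).stronglyMeasurable.norm.pow 2
  have hVi : Integrable (fun ω => ‖x ω - z ω‖ ^ 2) P := (hx2.sub hz2).integrable_norm_sq
  have hlc := (comap_measurable l).stronglyMeasurable
  have c1 := condExp_add hVi ((hlU.smul (2 : ℝ)).add hlW) m
  have c2 := condExp_add (hlU.smul (2 : ℝ)) hlW m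
  have c3 := condExp_smul (μ := P) (2 : ℝ) (l * U) m
  have c4 := condExp_mul_of_indep hmm hm' hlm.comap_le hind hlc hUm (hl.integrable le_top) hlU
  have c5 := condExp_mul_of_indep hmm hm' hlm.comap_le hind (hlc.mul hlc) hWm
    (hll.integrable le_top) hlW
  -- Here `⟨z - x, d⟩ = ⟨z, d⟩ - ‖d‖² - A`. The term `-‖d‖²`, weighted by `2 E l`, combines with `E
  -- l² ‖d‖²` into `-E(l(2 - l)) ‖d‖²`.
  have c6 : P[U | m] =ᵐ[P] P[fun ω => (inner ℝ (z ω) (d ω) : ℝ) | m] - P[W + A | m] := by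
    have hUdec : U = (fun ω => inner ℝ (z ω) (d ω)) - (W + A) := by
      funext ω
      simp only [hU, hW, Pi.sub_apply, Pi.add_apply, inner_sub_left, hxd]
    rw [hUdec]
    exact condExp_sub (hz2.integrable_real_inner hd2) (hWi.add hA) m
  have c7 := condExp_add hWi hA m
  have c8 : P[fun ω => (inner ℝ (z ω) (d ω) : ℝ) | m] =ᵐ[P]
      fun ω => inner ℝ (z ω) ((P[d | m]) ω) :=
    condExp_bilin_of_stronglyMeasurable_left (innerSL ℝ) hz.stronglyMeasurable
      (hz2.integrable_real_inner hd2) (hd2.integrable one_le_two)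
  rw [condExp_of_stronglyMeasurable (hmm.trans hm') hVm hVi] at c1
  rw [hdec]
  filter_upwards [c1, c2, c3, c4, c5, c6, c7, c8, hze] with ω h1 h2 h3 h4 h5 h6 h7 h8 h9
  rw [h1, Pi.add_apply, h2, Pi.add_apply, h3, Pi.smul_apply, h4, h5, h6, Pi.sub_apply, h7,
    Pi.add_apply, h8, integral_mul_two_sub hl, smul_eq_mul]
  have h10 := mul_le_mul_of_nonneg_left h9 hl0
  linarith

end RelaxedStep

/-! ### The step direction and the natural filtration -/

section StepDirection

variable {Ω H : Type*} [NormedAddCommGroup H] [InnerProductSpace ℝ H]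
  (x t : Ω → H) (η : Ω → ℝ) (ω : Ω)

theorem inner_stepDir :
    inner ℝ (x ω) (stepDir x t η ω) = ‖stepDir x t η ω‖ ^ 2 + stepCoeff x t η ω * η ω := by
  by_cases hω : ω ∈ activeSet x t η
  · have ht : ‖t ω‖ ≠ 0 := norm_ne_zero_iff.2 hω.1
    simp only [stepDir, stepCoeff, indicator_of_mem hω, inner_smul_right, norm_smul, mul_pow,
      Real.norm_eq_abs, sq_abs]
    field_simp
    ring
  · simp [stepDir, stepCoeff, hω]

theorem abs_stepCoeff_mul_eq : |stepCoeff x t η ω * η ω| =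
    ‖stepDir x t η ω‖ * ‖(activeSet x t η).indicator (fun ω => η ω / ‖t ω‖) ω‖ := by
  by_cases hω : ω ∈ activeSet x t η
  · have ht : ‖t ω‖ ≠ 0 := norm_ne_zero_iff.2 hω.1
    simp only [stepDir, stepCoeff, indicator_of_mem hω, norm_smul, Real.norm_eq_abs, abs_mul,
      abs_div, abs_norm]
    field_simp
  · simp [stepDir, stepCoeff, hω]

/-- `‖d‖² = ⟨x, d⟩ - αη` and `|αη| = ‖d‖ |1_A η/‖t‖|`; Cauchy–Schwarz and division by `‖d‖`
conclude. This bound puts `d` in `L²`. -/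
theorem norm_stepDir_le : ‖stepDir x t η ω‖ ≤
    ‖x ω‖ + ‖(activeSet x t η).indicator (fun ω => η ω / ‖t ω‖) ω‖ := by
  rcases (norm_nonneg (stepDir x t η ω)).eq_or_lt with h0 | h0
  · rw [← h0]; positivity
  · have h1 := inner_stepDir x t η ω
    have h2 := real_inner_le_norm (x ω) (stepDir x t η ω)
    have h3 := (abs_le.1 (abs_stepCoeff_mul_eq x t η ω).le).1
    refine le_of_mul_le_mul_right ?_ h0
    nlinarith

variable [MeasurableSpace Ω] [SecondCountableTopology H] [MeasurableSpace H] [BorelSpace H]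
  {x t η}

theorem measurable_stepCoeff (hx : Measurable x) (ht : Measurable t) (hη : Measurable η) :
    Measurable (stepCoeff x t η) := by
  refine Measurable.indicator (((hx.inner ht).sub hη).div (ht.norm.pow_const 2)) ?_
  exact (ht (measurableSet_singleton 0).compl).inter (measurableSet_lt hη (hx.inner ht))

theorem measurable_stepDir (hx : Measurable x) (ht : Measurable t) (hη : Measurable η) :
    Measurable (stepDir x t η) :=
  (measurable_stepCoeff hx ht hη).smul ht

end StepDirection

section PastSigma

variable {Ω H : Type*} [MeasurableSpace H]

theorem pastSigma_mono (x : ℕ → Ω → H) : Monotone (pastSigma x) :=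
  fun _ _ hij => biSup_mono fun _ hk => hk.trans hij

theorem measurable_pastSigma (x : ℕ → Ω → H) {k n : ℕ} (hk : k ≤ n) :
    Measurable[pastSigma x n] (x k) :=
  (comap_measurable (x k)).mono (le_iSup₂_of_le k hk le_rfl) le_rfl

variable [mΩ : MeasurableSpace Ω]

theorem pastSigma_le {x : ℕ → Ω → H} (hx : ∀ n, Measurable (x n)) (n : ℕ) :
    pastSigma x n ≤ mΩ :=
  iSup₂_le fun k _ => (hx k).comap_le

/-- The natural filtration of a sequence of random variables. -/
def pastFiltration (x : ℕ → Ω → H) (hx : ∀ n, Measurable (x n)) : Filtration ℕ mΩ where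
  seq := pastSigma x
  mono' := pastSigma_mono x
  le' := pastSigma_le hx

end PastSigma

/-! ### Integrability of the iterates and the basic inequality -/

section Iteration

variable {Ω H : Type*} [mΩ : MeasurableSpace Ω] [NormedAddCommGroup H] [MeasurableSpace H]
  [InnerProductSpace ℝ H] [CompleteSpace H] [SecondCountableTopology H] [BorelSpace H]
  {P : Measure Ω} {Z : Set H} {x t : ℕ → Ω → H} {η : ℕ → Ω → ℝ} {ε : ℕ → Ω → H → ℝ}
  {lam : ℕ → Ω → ℝ}

namespace IsGeometricIteration

theorem measurable_dir (hx : IsGeometricIteration P Z x t η ε lam) (n : ℕ) :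
    Measurable (stepDir (x n) (t n) (η n)) :=
  measurable_stepDir (hx.measurable_x n) (hx.measurable_t n) (hx.measurable_eta n)

theorem memLp_dir_of_memLp (hx : IsGeometricIteration P Z x t η ε lam) {n : ℕ}
    (hn : MemLp (x n) 2 P) : MemLp (stepDir (x n) (t n) (η n)) 2 P :=
  (hn.norm.add (hx.memLp_eta_div n).norm).mono (hx.measurable_dir n).aestronglyMeasurable
    (Eventually.of_forall fun ω => (norm_stepDir_le _ _ _ ω).trans (le_abs_self _))

theorem memLp_x (hx : IsGeometricIteration P Z x t η ε lam) (n : ℕ) : MemLp (x n) 2 P := by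
  induction n with
  | zero => exact hx.memLp_zero
  | succ n ih =>
    have h := ih.sub ((hx.memLp_dir_of_memLp ih).smul (p := ⊤) (r := 2) (hx.memLp_lam n))
    exact (memLp_congr_ae (hx.update n)).2 h

theorem memLp_dir (hx : IsGeometricIteration P Z x t η ε lam) (n : ℕ) :
    MemLp (stepDir (x n) (t n) (η n)) 2 P :=
  hx.memLp_dir_of_memLp (hx.memLp_x n)

theorem integrable_stepCoeff_mul_eta (hx : IsGeometricIteration P Z x t η ε lam) (n : ℕ) :
    Integrable (fun ω => stepCoeff (x n) (t n) (η n) ω * η n ω) P := by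
  refine ((hx.memLp_dir n).norm.integrable_mul (hx.memLp_eta_div n).norm).mono
    ((measurable_stepCoeff (hx.measurable_x n) (hx.measurable_t n)
      (hx.measurable_eta n)).mul (hx.measurable_eta n)).aestronglyMeasurable
    (Eventually.of_forall fun ω => ?_)
  rw [Real.norm_eq_abs, abs_stepCoeff_mul_eq]
  exact le_abs_self _

end IsGeometricIteration

theorem IsGeometricIteration.integral_lam_nonneg {Ω H : Type*} [MeasurableSpace Ω]
    [NormedAddCommGroup H] [MeasurableSpace H] [InnerProductSpace ℝ H] [CompleteSpace H]
    {P : Measure Ω} {Z : Set H} {x t : ℕ → Ω → H} {η : ℕ → Ω → ℝ} {ε : ℕ → Ω → H → ℝ}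
    {lam : ℕ → Ω → ℝ} (hx : IsGeometricIteration P Z x t η ε lam) (n : ℕ) :
    0 ≤ ∫ ω, lam n ω ∂P :=
  integral_nonneg_of_ae ((hx.lam_pos n).mono fun _ h => h.le)

namespace IsSuperRelaxedIteration

theorem condExp_norm_sub_sq_le [IsProbabilityMeasure P]
    (hx : IsSuperRelaxedIteration P Z x t η ε lam) (n : ℕ) {z : Ω → H} {e : Ω → ℝ}
    (hz : Measurable[pastSigma x n] z) (hz2 : MemLp z 2 P)
    (hze : ∀ᵐ ω ∂P, inner ℝ (z ω) ((P[stepDir (x n) (t n) (η n) | pastSigma x n]) ω) ≤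
      (P[fun ω' => stepCoeff (x n) (t n) (η n) ω' * η n ω' | pastSigma x n]) ω + e ω) :
    ∀ᵐ ω ∂P, (P[fun ω' => ‖x (n + 1) ω' - z ω'‖ ^ 2 | pastSigma x n]) ω ≤
      ‖x n ω - z ω‖ ^ 2 - (∫ ω', lam n ω' * (2 - lam n ω') ∂P) *
        (P[fun ω' => ‖stepDir (x n) (t n) (η n) ω'‖ ^ 2 | pastSigma x n]) ω +
      2 * (∫ ω', lam n ω' ∂P) * e ω := by
  have hg := hx.toIsGeometricIteration
  have hstep := condExp_norm_relaxed_step_sub_sq_le le_sup_left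
    (sup_le (pastSigma_le hg.measurable_x n) (hg.measurable_dir n).comap_le)
    (measurable_pastSigma x le_rfl) hz ((comap_measurable _).mono le_sup_right le_rfl)
    (hg.memLp_x n) hz2 (hg.memLp_dir n) (hg.integrable_stepCoeff_mul_eta n)
    (inner_stepDir _ _ _) (hg.measurable_lam n) (hg.memLp_lam n) (hg.integral_lam_nonneg n)
    (hx.indep n) hze
  have hcongr := condExp_congr_ae (m := pastSigma x n) (μ := P)
    (f := fun ω => ‖x (n + 1) ω - z ω‖ ^ 2)
    (g := fun ω => ‖x n ω - lam n ω • stepDir (x n) (t n) (η n) ω - z ω‖ ^ 2)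
    ((hx.update n).mono fun ω hω => by simp only [hω])
  filter_upwards [hstep, hcongr] with ω h1 h2
  rwa [h2]

end IsSuperRelaxedIteration

end Iteration

/-! ### Auxiliary summability and recursion lemmas -/

section RealSequences

theorem sum_add_le_of_succ_add_le {V a b : ℕ → ℝ} (h : ∀ n, V (n + 1) + a n ≤ V n + b n) (n : ℕ) :
    V n + ∑ k ∈ Finset.range n, a k ≤ V 0 + ∑ k ∈ Finset.range n, b k := by
  induction n with
  | zero => simp
  | succ n ih =>
    rw [Finset.sum_range_succ, Finset.sum_range_succ]
    linarith [h n]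

theorem summable_of_succ_add_le {V a b : ℕ → ℝ} (hV : ∀ n, 0 ≤ V n) (ha : ∀ n, 0 ≤ a n)
    (hb0 : ∀ n, 0 ≤ b n) (hb : Summable b) (h : ∀ n, V (n + 1) + a n ≤ V n + b n) :
    Summable a :=
  summable_of_sum_range_le (c := V 0 + ∑' n, b n) ha fun n => by
    linarith [hV n, sum_add_le_of_succ_add_le h n, hb.sum_le_tsum (Finset.range n) fun k _ => hb0 k]

theorem le_add_tsum_of_succ_add_le {V a b : ℕ → ℝ} (ha : ∀ n, 0 ≤ a n)
    (hb0 : ∀ n, 0 ≤ b n) (hb : Summable b) (h : ∀ n, V (n + 1) + a n ≤ V n + b n) (n : ℕ) :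
    V n ≤ V 0 + ∑' n, b n := by
  linarith [sum_add_le_of_succ_add_le h n, hb.sum_le_tsum (Finset.range n) fun k _ => hb0 k,
    Finset.sum_nonneg fun k (_ : k ∈ Finset.range n) => ha k]

theorem summable_of_iInf_pos_of_summable_mul {c s : ℕ → ℝ} (hc0 : ∀ n, 0 ≤ c n)
    (hs : ∀ n, 0 ≤ s n) (hc : 0 < ⨅ n, c n) (h : Summable fun n => c n * s n) : Summable s := by
  have hle : ∀ n, (⨅ n, c n) ≤ c n := ciInf_le ⟨0, by rintro _ ⟨n, rfl⟩; exact hc0 n⟩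
  refine (summable_mul_left_iff hc.ne').1 (Summable.of_nonneg_of_le
    (fun n => mul_nonneg hc.le (hs n)) (fun n => ?_) h)
  exact mul_le_mul_of_nonneg_right (hle n) (hs n)

theorem le_pow_mul_add_sum_of_succ_le {u b : ℕ → ℝ} {χ : ℝ} (hχ : 0 ≤ χ)
    (h : ∀ n, u (n + 1) ≤ χ * u n + 2 * b n) (n : ℕ) :
    u n ≤ χ ^ n * u 0 + 2 * ∑ j ∈ Finset.range n, χ ^ (n - j - 1) * b j := by
  induction n with
  | zero => simp
  | succ n ih =>
    have h1 : ∑ j ∈ Finset.range (n + 1), χ ^ (n + 1 - j - 1) * b j =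
        χ * ∑ j ∈ Finset.range n, χ ^ (n - j - 1) * b j + b n := by
      rw [Finset.sum_range_succ, Finset.mul_sum]
      congr 1
      · refine Finset.sum_congr rfl fun j hj => ?_
        have : n + 1 - j - 1 = n - j - 1 + 1 := by
          have := Finset.mem_range.1 hj
          omega
        rw [this, pow_succ]
        ring
      · simp
    rw [h1, pow_succ]
    have := mul_le_mul_of_nonneg_left ih hχ
    linarith [h n]

end RealSequences

section AlmostSureSummability

variable {Ω : Type*} [MeasurableSpace Ω] {P : Measure Ω}

theorem ae_summable_of_summable_integral {f : ℕ → Ω → ℝ} (hf : ∀ n, Integrable (f n) P)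
    (hf0 : ∀ n, ∀ᵐ ω ∂P, 0 ≤ f n ω) (h : Summable fun n => ∫ ω, f n ω ∂P) :
    ∀ᵐ ω ∂P, Summable fun n => f n ω := by
  have hlt : ∫⁻ ω, ∑' n, ENNReal.ofReal (f n ω) ∂P ≠ ⊤ := by
    rw [lintegral_tsum fun n => (hf n).1.aemeasurable.ennreal_ofReal]
    simp_rw [fun n => (ofReal_integral_eq_lintegral_ofReal (hf n) (hf0 n)).symm]
    exact h.tsum_ofReal_ne_top
  have hm : AEMeasurable (fun ω => ∑' n, ENNReal.ofReal (f n ω)) P :=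
    AEMeasurable.tsum fun n => (hf n).1.aemeasurable.ennreal_ofReal
  filter_upwards [ae_lt_top' hm hlt, ae_all_iff.2 hf0] with ω hω h0
  have := ENNReal.summable_toReal hω.ne
  simpa only [ENNReal.toReal_ofReal (h0 _)] using this

end AlmostSureSummability

/-! ### Mean squared distance to the target set -/

section DistanceToSet

variable {Ω H : Type*} [MeasurableSpace Ω] [NormedAddCommGroup H] {P : Measure Ω}
  [IsFiniteMeasure P] {Z : Set H}

theorem integrable_infDist_sq {f : Ω → H} (hZ : Z.Nonempty) (hf : MemLp f 2 P) :
    Integrable (fun ω => Metric.infDist (f ω) Z ^ 2) P := by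
  obtain ⟨z, hz⟩ := hZ
  have h : MemLp (fun ω => Metric.infDist (f ω) Z) 2 P :=
    (hf.sub (memLp_const z)).mono
      ((Metric.continuous_infDist_pt Z).comp_aestronglyMeasurable hf.1)
      (Eventually.of_forall fun ω => by
        rw [Real.norm_of_nonneg Metric.infDist_nonneg, Pi.sub_apply, ← dist_eq_norm]
        exact Metric.infDist_le_dist_of_mem hz)
  exact h.integrable_sq

/-- The distance is 1-Lipschitz, so `E d_Z²(y) ≤ 2 E‖x n - y‖² + 2 E d_Z²(x n)`. As the first term
tends to 0, the second need be small only for infinitely many `n`. -/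
theorem ae_mem_of_tendsto_L2 {x : ℕ → Ω → H} (hZ : Z.Nonempty) (hcl : IsClosed Z) {y : Ω → H}
    (hx2 : ∀ n, MemLp (x n) 2 P) (hy : MemLp y 2 P)
    (hlim : Tendsto (fun n => ∫ ω, ‖x n ω - y ω‖ ^ 2 ∂P) atTop (𝓝 0))
    (hd : ∀ δ > 0, ∃ᶠ n in atTop, ∫ ω, Metric.infDist (x n ω) Z ^ 2 ∂P < δ) :
    ∀ᵐ ω ∂P, y ω ∈ Z := by
  have hyi := integrable_infDist_sq hZ hy
  have hle : ∀ n, ∫ ω, Metric.infDist (y ω) Z ^ 2 ∂P ≤ 2 * ∫ ω, ‖x n ω - y ω‖ ^ 2 ∂P +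
      2 * ∫ ω, Metric.infDist (x n ω) Z ^ 2 ∂P := fun n => by
    have h1 : Integrable (fun ω => ‖x n ω - y ω‖ ^ 2) P := ((hx2 n).sub hy).integrable_norm_sq
    have h2 := integrable_infDist_sq hZ (hx2 n)
    rw [← integral_const_mul, ← integral_const_mul,
      ← integral_add (h1.const_mul 2) (h2.const_mul 2)]
    refine integral_mono hyi ((h1.const_mul 2).add (h2.const_mul 2)) fun ω => ?_
    have h3 : Metric.infDist (y ω) Z ≤ Metric.infDist (x n ω) Z + ‖x n ω - y ω‖ := by
      rw [← dist_eq_norm, dist_comm]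
      exact Metric.infDist_le_infDist_add_dist
    have h4 := pow_le_pow_left₀ Metric.infDist_nonneg h3 2
    simp only
    nlinarith [sq_nonneg (Metric.infDist (x n ω) Z - ‖x n ω - y ω‖)]
  have h0 : ∫ ω, Metric.infDist (y ω) Z ^ 2 ∂P = 0 := by
    refine le_antisymm (le_of_forall_pos_le_add fun δ hδ => ?_)
      (integral_nonneg fun ω => sq_nonneg _)
    obtain ⟨n, hn1, hn2⟩ := ((hd (δ / 4) (by positivity)).and_eventually
      (hlim.eventually (gt_mem_nhds (show (0 : ℝ) < δ / 4 by positivity)))).exists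
    linarith [hle n]
  filter_upwards [(integral_eq_zero_iff_of_nonneg (fun ω => sq_nonneg _) hyi).1 h0] with ω hω
  exact (hcl.mem_iff_infDist_zero hZ).2 (pow_eq_zero_iff two_ne_zero |>.1 hω)

end DistanceToSet

/-! ### Convergence of the iteration -/

section Convergence

set_option linter.unusedSectionVars false

variable {Ω H : Type*} [mΩ : MeasurableSpace Ω] [NormedAddCommGroup H] [MeasurableSpace H]
  [InnerProductSpace ℝ H] [CompleteSpace H] [SecondCountableTopology H] [BorelSpace H]
  {P : Measure Ω} [IsProbabilityMeasure P] {Z : Set H} {x t : ℕ → Ω → H} {η : ℕ → Ω → ℝ}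
  {ε : ℕ → Ω → H → ℝ} {lam : ℕ → Ω → ℝ}

namespace IsSuperRelaxedIteration

theorem integrable_norm_sub_sq (hx : IsSuperRelaxedIteration P Z x t η ε lam) (n : ℕ) (z : H) :
    Integrable (fun ω => ‖x n ω - z‖ ^ 2) P :=
  ((hx.memLp_x n).sub (memLp_const z)).integrable_norm_sq

theorem condExp_norm_sub_const_sq_le (hx : IsSuperRelaxedIteration P Z x t η ε lam) (n : ℕ)
    {z : H} (hz : z ∈ Z) :
    ∀ᵐ ω ∂P, (P[fun ω' => ‖x (n + 1) ω' - z‖ ^ 2 | pastSigma x n]) ω ≤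
      ‖x n ω - z‖ ^ 2 - (∫ ω', lam n ω' * (2 - lam n ω') ∂P) *
        (P[fun ω' => ‖stepDir (x n) (t n) (η n) ω'‖ ^ 2 | pastSigma x n]) ω +
      2 * (∫ ω', lam n ω' ∂P) * ε n ω z :=
  hx.condExp_norm_sub_sq_le n (z := fun _ => z) measurable_const (memLp_const z)
    (hx.outer_approx n z hz)

theorem ae_summable_and_tendsto_norm_sub_sq (hx : IsSuperRelaxedIteration P Z x t η ε lam)
    {z : H} (hz : z ∈ Z) (hε : ∀ᵐ ω ∂P, Summable fun n => ε n ω z * ∫ ω', lam n ω' ∂P) :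
    ∀ᵐ ω ∂P, (Summable fun n => (∫ ω', lam n ω' * (2 - lam n ω') ∂P) *
        (P[fun ω' => ‖stepDir (x n) (t n) (η n) ω'‖ ^ 2 | pastSigma x n]) ω) ∧
      ∃ l, Tendsto (fun n => ‖x n ω - z‖ ^ 2) atTop (𝓝 l) := by
  have hcond0 : ∀ n, ∀ᵐ ω ∂P,
      0 ≤ (P[fun ω' => ‖stepDir (x n) (t n) (η n) ω'‖ ^ 2 | pastSigma x n]) ω := fun n =>
    condExp_nonneg (Eventually.of_forall fun ω => sq_nonneg _)
  refine ae_summable_and_tendsto_of_almost_supermartingale (pastFiltration x hx.measurable_x)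
    (V := fun n ω => ‖x n ω - z‖ ^ 2)
    (ξ := fun n ω => 2 * (∫ ω', lam n ω' ∂P) * ε n ω z)
    (fun n => ?_) (fun n => hx.integrable_norm_sub_sq n z)
    (fun n => Eventually.of_forall fun ω => sq_nonneg _) (fun n => ?_) (fun n => ?_) (fun n => ?_)
    (fun n => ?_) ?_ (fun n => hx.condExp_norm_sub_const_sq_le n hz)
  · exact ((measurable_pastSigma x le_rfl).sub_const z).stronglyMeasurable.norm.pow 2
  · exact stronglyMeasurable_condExp.const_mul _
  · exact integrable_condExp.const_mul _
  · filter_upwards [hcond0 n] with ω hω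
    exact mul_nonneg (hx.relax n) hω
  · filter_upwards [hx.eps_nonneg n z hz] with ω hω
    have := hx.integral_lam_nonneg n
    positivity
  · filter_upwards [hε] with ω hω
    refine (hω.mul_left 2).congr fun n => ?_
    ring

theorem ae_forall_tendsto_norm_sub (hx : IsSuperRelaxedIteration P Z x t η ε lam)
    (hε : ∀ z ∈ Z, ∀ᵐ ω ∂P, Summable fun n => ε n ω z * ∫ ω', lam n ω' ∂P) :
    ∀ᵐ ω ∂P, ∀ z ∈ Z, ∃ l, Tendsto (fun n => ‖x n ω - z‖) atTop (𝓝 l) := by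
  obtain ⟨D, hDZ, hDc, hD⟩ := (IsSeparable.of_separableSpace Z).exists_countable_dense_subset
  have : ∀ᵐ ω ∂P, ∀ z ∈ D, ∃ l, Tendsto (fun n => ‖x n ω - z‖ ^ 2) atTop (𝓝 l) :=
    (ae_ball_iff hDc).2 fun z hz =>
      (hx.ae_summable_and_tendsto_norm_sub_sq (hDZ hz) (hε z (hDZ hz))).mono fun ω h => h.2
  filter_upwards [this] with ω hω
  refine tendsto_norm_sub_of_dense hD fun z hz => ?_
  obtain ⟨l, hl⟩ := hω z hz
  refine ⟨√l, ((Real.continuous_sqrt.tendsto l).comp hl).congr fun n => ?_⟩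
  exact Real.sqrt_sq (norm_nonneg _)

theorem exists_weakTendstoAS (hx : IsSuperRelaxedIteration P Z x t η ε lam) (hZ : Z.Nonempty)
    (hε : ∀ z ∈ Z, ∀ᵐ ω ∂P, Summable fun n => ε n ω z * ∫ ω', lam n ω' ∂P)
    (hw : ∀ᵐ ω ∂P, weakClusterPts (fun n => x n ω) ⊆ Z) :
    ∃ y : Ω → H, IsRandomVariableIn Z y ∧ WeakTendstoAS P x y := by
  refine exists_randomVariable_weakLimit hZ hx.measurable_x ?_
  filter_upwards [hw, hx.ae_forall_tendsto_norm_sub hε] with ω h1 h2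
  exact exists_weakTendsto_of_opial hZ h2 h1

theorem exists_strongTendstoAS (hx : IsSuperRelaxedIteration P Z x t η ε lam) (hZ : Z.Nonempty)
    (hε : ∀ z ∈ Z, ∀ᵐ ω ∂P, Summable fun n => ε n ω z * ∫ ω', lam n ω' ∂P)
    (hs : ∀ᵐ ω ∂P, (strongClusterPts (fun n => x n ω) ∩ Z).Nonempty) :
    ∃ y : Ω → H, IsRandomVariableIn Z y ∧ StrongTendstoAS P x y := by
  refine exists_randomVariable_strongLimit hZ hx.measurable_x ?_
  filter_upwards [hs, hx.ae_forall_tendsto_norm_sub hε] with ω ⟨z, hzs, hzZ⟩ h2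
  obtain ⟨l, hl⟩ := h2 z hzZ
  exact ⟨z, hzZ, tendsto_of_strongClusterPts_of_tendsto_norm_sub hl hzs⟩

theorem ae_norm_increment_sq_le (hx : IsSuperRelaxedIteration P Z x t η ε lam) {ρ : ℝ}
    (hρ : ∀ᵐ ω ∂P, BddAbove (range fun n => lam n ω) ∧ (⨆ n, lam n ω) < ρ) (n : ℕ) :
    ∀ᵐ ω ∂P, ‖x (n + 1) ω - x n ω‖ ^ 2 ≤ ρ ^ 2 * ‖stepDir (x n) (t n) (η n) ω‖ ^ 2 := by
  filter_upwards [hρ, hx.update n, hx.lam_pos n] with ω ⟨hb, hlt⟩ hu hpos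
  -- Boundedness is essential: the real supremum of an unbounded family is 0 by convention.
  have hle : lam n ω ≤ ρ := (le_ciSup hb n).trans hlt.le
  rw [hu, sub_sub_cancel_left, norm_neg, norm_smul, mul_pow, Real.norm_of_nonneg hpos.le]
  gcongr

theorem integrable_increment (hx : IsSuperRelaxedIteration P Z x t η ε lam) (n : ℕ) :
    Integrable (fun ω => ‖x (n + 1) ω - x n ω‖ ^ 2) P :=
  ((hx.memLp_x (n + 1)).sub (hx.memLp_x n)).integrable_norm_sq

theorem ae_summable_condExp_increment (hx : IsSuperRelaxedIteration P Z x t η ε lam)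
    (hZ : Z.Nonempty)
    (hε : ∀ z ∈ Z, ∀ᵐ ω ∂P, Summable fun n => ε n ω z * ∫ ω', lam n ω' ∂P)
    (hinf : 0 < ⨅ n, ∫ ω, lam n ω * (2 - lam n ω) ∂P) {ρ : ℝ}
    (hρ : ∀ᵐ ω ∂P, BddAbove (range fun n => lam n ω) ∧ (⨆ n, lam n ω) < ρ) :
    ∀ᵐ ω ∂P, Summable fun n =>
      (P[fun ω' => ‖x (n + 1) ω' - x n ω'‖ ^ 2 | pastSigma x n]) ω := by
  obtain ⟨z, hz⟩ := hZ
  have hle : ∀ n, ∀ᵐ ω ∂P, (P[fun ω' => ‖x (n + 1) ω' - x n ω'‖ ^ 2 | pastSigma x n]) ω ≤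
      ρ ^ 2 * (P[fun ω' => ‖stepDir (x n) (t n) (η n) ω'‖ ^ 2 | pastSigma x n]) ω := fun n => by
    have hdi := (hx.memLp_dir n).integrable_norm_sq
    filter_upwards [condExp_mono (m := pastSigma x n) (hx.integrable_increment n)
      (hdi.const_mul (ρ ^ 2)) (hx.ae_norm_increment_sq_le hρ n),
      condExp_smul (μ := P) (ρ ^ 2) (fun ω' => ‖stepDir (x n) (t n) (η n) ω'‖ ^ 2)
        (pastSigma x n)] with ω h1 h2
    exact h1.trans_eq h2
  have h0 : ∀ n, ∀ᵐ ω ∂P,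
      0 ≤ (P[fun ω' => ‖x (n + 1) ω' - x n ω'‖ ^ 2 | pastSigma x n]) ω := fun n =>
    condExp_nonneg (Eventually.of_forall fun ω => sq_nonneg _)
  have h0' : ∀ n, ∀ᵐ ω ∂P,
      0 ≤ (P[fun ω' => ‖stepDir (x n) (t n) (η n) ω'‖ ^ 2 | pastSigma x n]) ω := fun n =>
    condExp_nonneg (Eventually.of_forall fun ω => sq_nonneg _)
  filter_upwards [hx.ae_summable_and_tendsto_norm_sub_sq hz (hε z hz), ae_all_iff.2 hle,
    ae_all_iff.2 h0, ae_all_iff.2 h0'] with ω h1 h2 h3 h4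
  exact Summable.of_nonneg_of_le h3 h2
    ((summable_of_iInf_pos_of_summable_mul hx.relax h4 hinf h1.1).mul_left _)

theorem ae_summable_increment (hx : IsSuperRelaxedIteration P Z x t η ε lam)
    (hZ : Z.Nonempty)
    (hε : ∀ z ∈ Z, ∀ᵐ ω ∂P, Summable fun n => ε n ω z * ∫ ω', lam n ω' ∂P)
    (hinf : 0 < ⨅ n, ∫ ω, lam n ω * (2 - lam n ω) ∂P) {ρ : ℝ}
    (hρ : ∀ᵐ ω ∂P, BddAbove (range fun n => lam n ω) ∧ (⨆ n, lam n ω) < ρ) :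
    ∀ᵐ ω ∂P, Summable fun n => ‖x (n + 1) ω - x n ω‖ ^ 2 :=
  ae_summable_of_ae_summable_condExp (pastFiltration x hx.measurable_x)
    (fun n => ((measurable_pastSigma x le_rfl).sub
      (measurable_pastSigma x n.le_succ)).stronglyMeasurable.norm.pow 2)
    hx.integrable_increment (fun _ _ => sq_nonneg _)
    (hx.ae_summable_condExp_increment hZ hε hinf hρ)

theorem integral_norm_sub_sq_add_le (hx : IsSuperRelaxedIteration P Z x t η ε lam) (n : ℕ)
    {z : Ω → H} {e : Ω → ℝ} (hz : Measurable[pastSigma x n] z) (hz2 : MemLp z 2 P)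
    (he : Integrable e P)
    (hze : ∀ᵐ ω ∂P, inner ℝ (z ω) ((P[stepDir (x n) (t n) (η n) | pastSigma x n]) ω) ≤
      (P[fun ω' => stepCoeff (x n) (t n) (η n) ω' * η n ω' | pastSigma x n]) ω + e ω) :
    ∫ ω, ‖x (n + 1) ω - z ω‖ ^ 2 ∂P + (∫ ω, lam n ω * (2 - lam n ω) ∂P) *
        ∫ ω, ‖stepDir (x n) (t n) (η n) ω‖ ^ 2 ∂P ≤
      ∫ ω, ‖x n ω - z ω‖ ^ 2 ∂P + 2 * ((∫ ω, e ω ∂P) * ∫ ω, lam n ω ∂P) := by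
  have hle := pastSigma_le hx.measurable_x n
  have hV : Integrable (fun ω => ‖x n ω - z ω‖ ^ 2) P :=
    ((hx.memLp_x n).sub hz2).integrable_norm_sq
  have hc : Integrable (fun ω => (∫ ω', lam n ω' * (2 - lam n ω') ∂P) *
      (P[fun ω' => ‖stepDir (x n) (t n) (η n) ω'‖ ^ 2 | pastSigma x n]) ω) P :=
    integrable_condExp.const_mul _
  have hVc : Integrable (fun ω => ‖x n ω - z ω‖ ^ 2 -
      (∫ ω', lam n ω' * (2 - lam n ω') ∂P) *
      (P[fun ω' => ‖stepDir (x n) (t n) (η n) ω'‖ ^ 2 | pastSigma x n]) ω) P := hV.sub hc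
  have hec := he.const_mul (2 * ∫ ω', lam n ω' ∂P)
  have h := integral_mono_ae integrable_condExp (hVc.add hec)
    (hx.condExp_norm_sub_sq_le n hz hz2 hze)
  simp only [Pi.add_apply] at h
  rw [integral_condExp hle, integral_add hVc hec, integral_sub hV hc,
    integral_const_mul, integral_const_mul, integral_condExp hle] at h
  linarith

theorem integral_norm_sub_const_sq_add_le (hx : IsSuperRelaxedIteration P Z x t η ε lam) (n : ℕ)
    {z : H} (hz : z ∈ Z) :
    ∫ ω, ‖x (n + 1) ω - z‖ ^ 2 ∂P + (∫ ω, lam n ω * (2 - lam n ω) ∂P) *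
        ∫ ω, ‖stepDir (x n) (t n) (η n) ω‖ ^ 2 ∂P ≤
      ∫ ω, ‖x n ω - z‖ ^ 2 ∂P + 2 * ((∫ ω, ε n ω z ∂P) * ∫ ω, lam n ω ∂P) :=
  hx.integral_norm_sub_sq_add_le n (z := fun _ => z) measurable_const (memLp_const z)
    (hx.integrable_eps n z hz) (hx.outer_approx n z hz)

theorem integral_eps_mul_nonneg (hx : IsSuperRelaxedIteration P Z x t η ε lam) (n : ℕ)
    (z : H) : 0 ≤ (∫ ω, ε n ω z ∂P) * ∫ ω, lam n ω ∂P :=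
  mul_nonneg (integral_nonneg fun ω => (hx.eps_caratheodory n).nonneg ω z)
    (hx.integral_lam_nonneg n)

theorem ae_summable_eps_of_summable_integral (hx : IsSuperRelaxedIteration P Z x t η ε lam)
    {z : H} (hz : z ∈ Z) (hε : Summable fun n => (∫ ω, ε n ω z ∂P) * ∫ ω, lam n ω ∂P) :
    ∀ᵐ ω ∂P, Summable fun n => ε n ω z * ∫ ω', lam n ω' ∂P :=
  ae_summable_of_summable_integral (fun n => (hx.integrable_eps n z hz).mul_const _)
    (fun n => (hx.eps_nonneg n z hz).mono fun ω h => mul_nonneg h (hx.integral_lam_nonneg n))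
    (by simpa only [integral_mul_const] using hε)

theorem summable_integral_norm_dir_sq (hx : IsSuperRelaxedIteration P Z x t η ε lam)
    {z : H} (hz : z ∈ Z) (hε : Summable fun n => (∫ ω, ε n ω z ∂P) * ∫ ω, lam n ω ∂P) :
    Summable fun n => (∫ ω, lam n ω * (2 - lam n ω) ∂P) *
      ∫ ω, ‖stepDir (x n) (t n) (η n) ω‖ ^ 2 ∂P :=
  summable_of_succ_add_le (V := fun n => ∫ ω, ‖x n ω - z‖ ^ 2 ∂P)
    (fun _ => integral_nonneg fun _ => sq_nonneg _)
    (fun n => mul_nonneg (hx.relax n) (integral_nonneg fun _ => sq_nonneg _))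
    (fun n => mul_nonneg zero_le_two (hx.integral_eps_mul_nonneg n z)) (hε.mul_left 2)
    (fun n => hx.integral_norm_sub_const_sq_add_le n hz)

theorem exists_integral_norm_sq_le (hx : IsSuperRelaxedIteration P Z x t η ε lam)
    {z : H} (hz : z ∈ Z) (hε : Summable fun n => (∫ ω, ε n ω z ∂P) * ∫ ω, lam n ω ∂P) :
    ∃ C, ∀ n, ∫ ω, ‖x n ω‖ ^ 2 ∂P ≤ C := by
  have hV := le_add_tsum_of_succ_add_le (V := fun n => ∫ ω, ‖x n ω - z‖ ^ 2 ∂P)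
    (fun n => mul_nonneg (hx.relax n) (integral_nonneg fun _ => sq_nonneg _))
    (fun n => mul_nonneg zero_le_two (hx.integral_eps_mul_nonneg n z)) (hε.mul_left 2)
    (fun n => hx.integral_norm_sub_const_sq_add_le n hz)
  refine ⟨2 * (∫ ω, ‖x 0 ω - z‖ ^ 2 ∂P + ∑' n, 2 * ((∫ ω, ε n ω z ∂P) * ∫ ω, lam n ω ∂P)) +
    2 * ∫ _, ‖z‖ ^ 2 ∂P, fun n => ?_⟩
  have h := integral_norm_add_sq_le ((hx.memLp_x n).sub (memLp_const z)) (memLp_const (μ := P) z)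
  simp only [Pi.sub_apply, sub_add_cancel] at h
  linarith [hV n]

theorem summable_integral_increment (hx : IsSuperRelaxedIteration P Z x t η ε lam)
    {z : H} (hz : z ∈ Z) (hε : Summable fun n => (∫ ω, ε n ω z ∂P) * ∫ ω, lam n ω ∂P)
    (hinf : 0 < ⨅ n, ∫ ω, lam n ω * (2 - lam n ω) ∂P) {ρ : ℝ}
    (hρ : ∀ᵐ ω ∂P, BddAbove (range fun n => lam n ω) ∧ (⨆ n, lam n ω) < ρ) :
    Summable fun n => ∫ ω, ‖x (n + 1) ω - x n ω‖ ^ 2 ∂P := by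
  refine Summable.of_nonneg_of_le (fun n => integral_nonneg fun ω => sq_nonneg _) (fun n => ?_)
    ((summable_of_iInf_pos_of_summable_mul hx.relax
      (fun n => integral_nonneg fun ω => sq_nonneg _) hinf
      (hx.summable_integral_norm_dir_sq hz hε)).mul_left (ρ ^ 2))
  rw [← integral_const_mul]
  exact integral_mono_ae (hx.integrable_increment n)
    ((hx.memLp_dir n).integrable_norm_sq.const_mul _) (hx.ae_norm_increment_sq_le hρ n)

/-- With a tolerance independent of `z` the inequality is a closed condition on `z`, so a countable
dense subset of `Z` gives a common null set. This permits random `z`. -/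
theorem ae_forall_inner_condExp_le (hx : IsSuperRelaxedIteration P Z x t η ε lam)
    (hc : ∀ n ω z, ε n ω z = ε n ω 0) (n : ℕ) :
    ∀ᵐ ω ∂P, ∀ z ∈ Z, inner ℝ z ((P[stepDir (x n) (t n) (η n) | pastSigma x n]) ω) ≤
      (P[fun ω' => stepCoeff (x n) (t n) (η n) ω' * η n ω' | pastSigma x n]) ω + ε n ω 0 := by
  obtain ⟨D, hDZ, hDc, hD⟩ := (IsSeparable.of_separableSpace Z).exists_countable_dense_subset
  have : ∀ᵐ ω ∂P, ∀ z ∈ D,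
      inner ℝ z ((P[stepDir (x n) (t n) (η n) | pastSigma x n]) ω) ≤
      (P[fun ω' => stepCoeff (x n) (t n) (η n) ω' * η n ω' | pastSigma x n]) ω + ε n ω 0 :=
    (ae_ball_iff hDc).2 fun z hz =>
      (hx.outer_approx n z (hDZ hz)).mono fun ω h => by rwa [hc] at h
  filter_upwards [this] with ω hω z hz
  have hcl : IsClosed {z : H | inner ℝ z ((P[stepDir (x n) (t n) (η n) | pastSigma x n]) ω) ≤
      (P[fun ω' => stepCoeff (x n) (t n) (η n) ω' * η n ω' | pastSigma x n]) ω + ε n ω 0} :=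
    isClosed_le (continuous_id.inner continuous_const) continuous_const
  exact closure_minimal (s := D) (fun z hz => hω z hz) hcl (hD hz)

theorem integral_norm_sub_sq_le_add_sum (hx : IsSuperRelaxedIteration P Z x t η ε lam)
    (hZ : Z.Nonempty) (hc : ∀ n ω z, ε n ω z = ε n ω 0) {n : ℕ} {z : Ω → H}
    (hz : Measurable[pastSigma x n] z) (hz2 : MemLp z 2 P) (hzZ : ∀ ω, z ω ∈ Z) (k : ℕ) :
    ∫ ω, ‖x (n + k) ω - z ω‖ ^ 2 ∂P ≤ ∫ ω, ‖x n ω - z ω‖ ^ 2 ∂P +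
      2 * ∑ j ∈ Finset.range k, (∫ ω, ε (n + j) ω 0 ∂P) * ∫ ω, lam (n + j) ω ∂P := by
  obtain ⟨z₀, hz₀⟩ := hZ
  have h := sum_add_le_of_succ_add_le (V := fun k => ∫ ω, ‖x (n + k) ω - z ω‖ ^ 2 ∂P)
    (a := fun k => (∫ ω, lam (n + k) ω * (2 - lam (n + k) ω) ∂P) *
      ∫ ω, ‖stepDir (x (n + k)) (t (n + k)) (η (n + k)) ω‖ ^ 2 ∂P)
    (b := fun j => 2 * ((∫ ω, ε (n + j) ω 0 ∂P) * ∫ ω, lam (n + j) ω ∂P)) (fun k => ?_) k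
  · rw [← Finset.mul_sum] at h
    have h0 := Finset.sum_nonneg fun i (_ : i ∈ Finset.range k) =>
      mul_nonneg (hx.relax (n + i)) (integral_nonneg (μ := P) fun ω =>
        sq_nonneg ‖stepDir (x (n + i)) (t (n + i)) (η (n + i)) ω‖)
    simp only [add_zero] at h
    linarith
  -- The origin may lie outside `Z`; integrability is borrowed from `z₀`.
  · have hint := hx.integrable_eps (n + k) z₀ hz₀
    simp only [hc _ _ z₀] at hint
    exact hx.integral_norm_sub_sq_add_le (n + k)
      (hz.mono (pastSigma_mono x (Nat.le_add_right n k)) le_rfl) hz2 hint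
      ((hx.ae_forall_inner_condExp_le hc (n + k)).mono fun ω h => h _ (hzZ ω))

/-- With `p` the projection, `E‖x (n + k) - p (x n)‖² ≤ E d_Z² + 2Σ`, where `d_Z` is taken at `x n`.
Inserting `p (x n)` between the two iterates gives `2(E d_Z² + 2Σ) + 2 E d_Z²`. -/
theorem integral_norm_sub_sq_le_infDist (hx : IsSuperRelaxedIteration P Z x t η ε lam)
    (hZ : Z.Nonempty) (hcl : IsClosed Z) (hconv : Convex ℝ Z)
    (hc : ∀ n ω z, ε n ω z = ε n ω 0)
    (hε : Summable fun n => (∫ ω, ε n ω 0 ∂P) * ∫ ω, lam n ω ∂P) (n k : ℕ) :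
    ∫ ω, ‖x (n + k) ω - x n ω‖ ^ 2 ∂P ≤ 4 * ∫ ω, Metric.infDist (x n ω) Z ^ 2 ∂P +
      4 * ∑' j, (∫ ω, ε (n + j) ω 0 ∂P) * ∫ ω, lam (n + j) ω ∂P := by
  obtain ⟨p, hpZ, hpd, hpL⟩ := exists_nonexpansive_projection hZ hcl hconv
  have hpx : MemLp (fun ω => p (x n ω)) 2 P := by
    refine ((hx.memLp_x n).norm.add (memLp_const ‖p 0‖)).mono
      (hpL.continuous.measurable.comp (hx.measurable_x n)).aestronglyMeasurable
      (Eventually.of_forall fun ω => ?_)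
    have h1 := hpL.dist_le_mul (x n ω) 0
    rw [NNReal.coe_one, one_mul, dist_eq_norm, dist_eq_norm, sub_zero] at h1
    have h2 : ‖p (x n ω)‖ ≤ ‖p (x n ω) - p 0‖ + ‖p 0‖ := by
      simpa using norm_add_le (p (x n ω) - p 0) (p 0)
    exact (h2.trans (add_le_add_left h1 _)).trans (le_abs_self _)
  have h1 := hx.integral_norm_sub_sq_le_add_sum hZ hc
    (hpL.continuous.measurable.comp (measurable_pastSigma x (le_refl n))) hpx
    (fun ω => hpZ _) k
  have h2 := integral_norm_add_sq_le ((hx.memLp_x (n + k)).sub hpx) (hpx.sub (hx.memLp_x n))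
  simp only [Pi.sub_apply, sub_add_sub_cancel, norm_sub_rev (p _) (x n _)] at h2
  simp only [Function.comp_apply, hpd] at h1 h2
  have hs : Summable fun j => (∫ ω, ε (n + j) ω 0 ∂P) * ∫ ω, lam (n + j) ω ∂P := by
    simpa only [add_comm n] using (summable_nat_add_iff n).2 hε
  have h3 := hs.sum_le_tsum (Finset.range k) fun j _ => hx.integral_eps_mul_nonneg (n + j) 0
  linarith

theorem exists_strongTendsto_of_frequently_infDist
    (hx : IsSuperRelaxedIteration P Z x t η ε lam)
    (hZ : Z.Nonempty) (hcl : IsClosed Z) (hconv : Convex ℝ Z)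
    (hc : ∀ n ω z, ε n ω z = ε n ω 0)
    (hε : ∀ z ∈ Z, Summable fun n => (∫ ω, ε n ω z ∂P) * ∫ ω, lam n ω ∂P)
    (hd : ∀ δ > 0, ∃ᶠ n in atTop, ∫ ω, Metric.infDist (x n ω) Z ^ 2 ∂P < δ) :
    ∃ y : Ω → H, IsRandomVariableIn Z y ∧ StrongTendstoLp P 2 x y ∧ StrongTendstoAS P x y := by
  have hε0 : Summable fun n => (∫ ω, ε n ω 0 ∂P) * ∫ ω, lam n ω ∂P := by
    obtain ⟨z, hz⟩ := hZ
    simpa only [hc _ _ z] using hε z hz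
  obtain ⟨w, hw, hlim⟩ := exists_tendsto_of_cauchy_integral_norm_sq hx.memLp_x (by
    intro δ hδ
    have htail : Tendsto (fun n => ∑' j, (∫ ω, ε (n + j) ω 0 ∂P) * ∫ ω, lam (n + j) ω ∂P)
        atTop (𝓝 0) := by
      simpa only [add_comm] using
        tendsto_sum_nat_add fun n => (∫ ω, ε n ω 0 ∂P) * ∫ ω, lam n ω ∂P
    obtain ⟨N, hN1, hN2⟩ := ((hd (δ / 8) (by positivity)).and_eventually
      (htail.eventually (gt_mem_nhds (show (0 : ℝ) < δ / 8 by positivity)))).exists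
    refine ⟨N, fun n hn => ?_⟩
    obtain ⟨k, rfl⟩ := Nat.exists_eq_add_of_le hn
    linarith [hx.integral_norm_sub_sq_le_infDist hZ hcl hconv hc hε0 N k])
  have hint := (tendsto_eLpNorm_two_iff fun n => (hx.memLp_x n).sub hw).1 hlim
  have hwZ := ae_mem_of_tendsto_L2 hZ hcl hx.memLp_x hw hint hd
  -- An a.s. convergent subsequence supplies a strong cluster point in `Z`, which upgrades to a.s.
  -- convergence of the whole sequence.
  obtain ⟨ns, hns, hae⟩ := (tendstoInMeasure_of_tendsto_eLpNorm two_ne_zero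
    (fun n => (hx.memLp_x n).1) hw.1 hlim).exists_seq_tendsto_ae
  obtain ⟨y, hy, hyAS⟩ := hx.exists_strongTendstoAS hZ
    (fun z hz => hx.ae_summable_eps_of_summable_integral hz (hε z hz)) (by
      filter_upwards [hwZ, hae] with ω h1 h2
      exact ⟨w ω, ⟨ns, hns, h2⟩, h1⟩)
  have hyw : y =ᵐ[P] w := by
    filter_upwards [hae, hyAS] with ω h1 h2
    exact tendsto_nhds_unique (h2.comp hns.tendsto_atTop) h1
  refine ⟨y, hy, ⟨hx.memLp_x, (memLp_congr_ae hyw).2 hw, ?_⟩, hyAS⟩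
  refine hlim.congr fun n => eLpNorm_congr_ae ?_
  filter_upwards [hyw] with ω hω
  rw [hω]

theorem integral_infDist_sq_succ_le (hx : IsSuperRelaxedIteration P Z x t η ε lam)
    (hZ : Z.Nonempty) (hc : ∀ n ω z, ε n ω z = ε n ω 0) {χ : ℝ} {n : ℕ}
    (h : ∀ᵐ ω ∂P, (P[fun ω' => Metric.infDist (x (n + 1) ω') Z ^ 2 | pastSigma x n]) ω ≤
      χ * Metric.infDist (x n ω) Z ^ 2 + 2 * ε n ω 0 * ∫ ω', lam n ω' ∂P) :
    ∫ ω, Metric.infDist (x (n + 1) ω) Z ^ 2 ∂P ≤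
      χ * ∫ ω, Metric.infDist (x n ω) Z ^ 2 ∂P +
        2 * ((∫ ω, ε n ω 0 ∂P) * ∫ ω, lam n ω ∂P) := by
  have hi : Integrable (fun ω => ε n ω 0) P := by
    obtain ⟨z, hz⟩ := hZ
    simpa only [hc _ _ z] using hx.integrable_eps n z hz
  have hd := (integrable_infDist_sq hZ (hx.memLp_x n)).const_mul χ
  have he := (hi.const_mul 2).mul_const (∫ ω', lam n ω' ∂P)
  have h1 := integral_mono_ae integrable_condExp (hd.add he) h
  simp only [Pi.add_apply] at h1
  rw [integral_condExp (pastSigma_le hx.measurable_x n), integral_add hd he, integral_const_mul,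
    integral_mul_const, integral_const_mul, mul_assoc] at h1
  exact h1

end IsSuperRelaxedIteration

end Convergence

/-! ### The main theorem -/

theorem theorem3p6 {Ω H : Type*} [MeasurableSpace Ω]
    [NormedAddCommGroup H] [InnerProductSpace ℝ H] [CompleteSpace H] [SeparableSpace H]
    [MeasurableSpace H] [BorelSpace H]
    (P : Measure Ω) [IsProbabilityMeasure P] [P.IsComplete]
    (Z : Set H) (hZne : Z.Nonempty) (hZcl : IsClosed Z)
    (x t : ℕ → Ω → H) (η : ℕ → Ω → ℝ) (ε : ℕ → Ω → H → ℝ) (lam : ℕ → Ω → ℝ)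
    (d : ℕ → Ω → H) (hd : ∀ n, d n = stepDir (x n) (t n) (η n))
    (hx : IsSuperRelaxedIteration P Z x t η ε lam) :
    -- the iterates and the directions are well defined in `L²`
    (∀ n, MemLp (x n) 2 P ∧ MemLp (d n) 2 P) ∧
    -- part (i)
    ((∀ z ∈ Z, ∀ᵐ ω ∂P, Summable (fun n => ε n ω z * ∫ ω', lam n ω' ∂P)) →
      -- (a)
      (∀ᵐ ω ∂P, Summable (fun n => (∫ ω', lam n ω' * (2 - lam n ω') ∂P) *
        (P[fun ω' => ‖d n ω'‖ ^ 2 | pastSigma x n]) ω)) ∧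
      -- (b)
      (0 < (⨅ n, ∫ ω, lam n ω * (2 - lam n ω) ∂P) →
        (∃ ρ : ℝ, 1 ≤ ρ ∧
          ∀ᵐ ω ∂P, BddAbove (range (fun n => lam n ω)) ∧ (⨆ n, lam n ω) < ρ) →
        (∀ᵐ ω ∂P, Summable (fun n =>
          (P[fun ω' => ‖x (n + 1) ω' - x n ω'‖ ^ 2 | pastSigma x n]) ω)) ∧
        (∀ᵐ ω ∂P, Summable (fun n => ‖x (n + 1) ω - x n ω‖ ^ 2))) ∧
      -- (c)
      ((∀ᵐ ω ∂P, weakClusterPts (fun n => x n ω) ⊆ Z) →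
        ∃ y : Ω → H, IsRandomVariableIn Z y ∧ WeakTendstoAS P x y) ∧
      -- (d)
      ((∀ᵐ ω ∂P, (strongClusterPts (fun n => x n ω) ∩ Z).Nonempty) →
        ∃ y : Ω → H, IsRandomVariableIn Z y ∧ StrongTendstoAS P x y) ∧
      -- (e)
      ((∀ᵐ ω ∂P, (strongClusterPts (fun n => x n ω)).Nonempty) →
        (∀ᵐ ω ∂P, weakClusterPts (fun n => x n ω) ⊆ Z) →
        ∃ y : Ω → H, IsRandomVariableIn Z y ∧ StrongTendstoAS P x y)) ∧
    -- part (ii)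
    ((∀ z ∈ Z, Summable (fun n => (∫ ω, ε n ω z ∂P) * ∫ ω, lam n ω ∂P)) →
      -- (a)
      Summable (fun n => (∫ ω, lam n ω * (2 - lam n ω) ∂P) * ∫ ω, ‖d n ω‖ ^ 2 ∂P) ∧
      -- (b)
      (0 < (⨅ n, ∫ ω, lam n ω * (2 - lam n ω) ∂P) →
        (∃ ρ : ℝ, 1 ≤ ρ ∧
          ∀ᵐ ω ∂P, BddAbove (range (fun n => lam n ω)) ∧ (⨆ n, lam n ω) < ρ) →
        Summable (fun n => ∫ ω, ‖x (n + 1) ω - x n ω‖ ^ 2 ∂P)) ∧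
      -- (c)
      ((∀ᵐ ω ∂P, weakClusterPts (fun n => x n ω) ⊆ Z) →
        ∃ y : Ω → H, IsL2In P Z y ∧ WeakTendstoAS P x y ∧ WeakTendstoL2 P x y) ∧
      -- (d)
      ((∀ᵐ ω ∂P, (strongClusterPts (fun n => x n ω) ∩ Z).Nonempty) →
        ∃ y : Ω → H, IsL2In P Z y ∧ StrongTendstoAS P x y ∧ StrongTendstoLp P 1 x y ∧
          WeakTendstoL2 P x y) ∧
      -- (e)
      (Convex ℝ Z → (∀ n ω z, ε n ω z = ε n ω 0) →
        liminf (fun n => ((∫ ω, Metric.infDist (x n ω) Z ^ 2 ∂P : ℝ) : EReal)) atTop = 0 →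
        ∃ y : Ω → H, IsRandomVariableIn Z y ∧ StrongTendstoLp P 2 x y ∧
          StrongTendstoAS P x y) ∧
      -- (f)
      (Convex ℝ Z → (∀ n ω z, ε n ω z = ε n ω 0) →
        ∀ χ : ℝ, 0 < χ → χ < 1 →
        (∀ n, ∀ᵐ ω ∂P, (P[fun ω' => Metric.infDist (x (n + 1) ω') Z ^ 2 | pastSigma x n]) ω ≤
          χ * Metric.infDist (x n ω) Z ^ 2 + 2 * ε n ω 0 * ∫ ω', lam n ω' ∂P) →
        -- [A]
        (∀ n, ∫ ω, Metric.infDist (x (n + 1) ω) Z ^ 2 ∂P ≤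
          χ ^ (n + 1) * (∫ ω, Metric.infDist (x 0 ω) Z ^ 2 ∂P) +
          2 * ∑ j ∈ Finset.range (n + 1),
            χ ^ (n - j) * ((∫ ω, ε j ω 0 ∂P) * ∫ ω, lam j ω ∂P)) ∧
        -- [B]
        (∃ y : Ω → H, IsL2In P Z y ∧ StrongTendstoLp P 2 x y ∧ StrongTendstoAS P x y ∧
          ∀ n, ∫ ω, ‖x n ω - y ω‖ ^ 2 ∂P ≤
            4 * χ ^ n * (∫ ω, Metric.infDist (x 0 ω) Z ^ 2 ∂P) +
            8 * (∑ j ∈ Finset.range n,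
              χ ^ (n - j - 1) * ((∫ ω, ε j ω 0 ∂P) * ∫ ω, lam j ω ∂P)) +
            4 * ∑' j : ℕ, (∫ ω, ε (n + j) ω 0 ∂P) * ∫ ω, lam (n + j) ω ∂P))) := by
  have : SecondCountableTopology H := UniformSpace.secondCountable_of_separable H
  obtain rfl : d = fun n => stepDir (x n) (t n) (η n) := funext hd
  refine ⟨fun n => ⟨hx.memLp_x n, hx.memLp_dir n⟩, fun hε => ⟨?_, ?_, ?_, ?_, ?_⟩, fun hε => ?_⟩
  · obtain ⟨z, hz⟩ := hZne
    exact (hx.ae_summable_and_tendsto_norm_sub_sq hz (hε z hz)).mono fun ω h => h.1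
  · rintro hinf ⟨ρ, -, hρ⟩
    exact ⟨hx.ae_summable_condExp_increment hZne hε hinf hρ,
      hx.ae_summable_increment hZne hε hinf hρ⟩
  · exact hx.exists_weakTendstoAS hZne hε
  · exact hx.exists_strongTendstoAS hZne hε
  · intro hs hw
    refine hx.exists_strongTendstoAS hZne hε ?_
    filter_upwards [hs, hw] with ω ⟨z, hz⟩ h
    exact ⟨z, hz, h (strongClusterPts_subset_weakClusterPts _ hz)⟩
  obtain ⟨z, hz⟩ := id hZne
  have hεas : ∀ z ∈ Z, ∀ᵐ ω ∂P, Summable fun n => ε n ω z * ∫ ω', lam n ω' ∂P :=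
    fun z hz => hx.ae_summable_eps_of_summable_integral hz (hε z hz)
  obtain ⟨C, hC⟩ := hx.exists_integral_norm_sq_le hz (hε z hz)
  refine ⟨hx.summable_integral_norm_dir_sq hz (hε z hz), ?_, ?_, ?_, ?_, ?_⟩
  · rintro hinf ⟨ρ, -, hρ⟩
    exact hx.summable_integral_increment hz (hε z hz) hinf hρ
  · intro hw
    obtain ⟨y, hy, hlim⟩ := hx.exists_weakTendstoAS hZne hεas hw
    have hy2 := (memLp_and_integral_norm_sq_le_of_weakTendstoAS hx.memLp_x
      hy.1.aestronglyMeasurable hC hlim).1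
    exact ⟨y, ⟨hy.1, hy2, Eventually.of_forall hy.2⟩, hlim,
      weakTendstoL2_of_weakTendstoAS hx.memLp_x hy2 hC hlim⟩
  · intro hs
    obtain ⟨y, hy, hlim⟩ := hx.exists_strongTendstoAS hZne hεas hs
    have hwlim : WeakTendstoAS P x y := hlim.mono fun ω hω => hω.weakTendsto
    have hy2 := (memLp_and_integral_norm_sq_le_of_weakTendstoAS hx.memLp_x
      hy.1.aestronglyMeasurable hC hwlim).1
    exact ⟨y, ⟨hy.1, hy2, Eventually.of_forall hy.2⟩, hlim,
      strongTendstoLp_one_of_strongTendstoAS hx.memLp_x hy2 hC hlim,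
      weakTendstoL2_of_weakTendstoAS hx.memLp_x hy2 hC hwlim⟩
  · intro hconv hc hlim
    refine hx.exists_strongTendsto_of_frequently_infDist hZne hZcl hconv hc hε fun δ hδ => ?_
    have hlt : liminf (fun n => ((∫ ω, Metric.infDist (x n ω) Z ^ 2 ∂P : ℝ) : EReal)) atTop <
        (δ : EReal) := by
      rw [hlim]
      exact_mod_cast hδ
    exact (frequently_lt_of_liminf_lt (by isBoundedDefault) hlt).mono fun n hn =>
      EReal.coe_lt_coe_iff.1 hn
  · intro hconv hc χ hχ0 hχ1 hrec
    have hsucc := fun n => hx.integral_infDist_sq_succ_le hZne hc (hrec n)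
    have hbound := le_pow_mul_add_sum_of_succ_le
      (u := fun n => ∫ ω, Metric.infDist (x n ω) Z ^ 2 ∂P)
      (b := fun n => (∫ ω, ε n ω 0 ∂P) * ∫ ω, lam n ω ∂P) hχ0.le hsucc
    have hε0 : Summable fun n => (∫ ω, ε n ω 0 ∂P) * ∫ ω, lam n ω ∂P := by
      simpa only [hc _ _ z] using hε z hz
    -- The recursion reads `V (n + 1) + (1 - χ) V n ≤ V n + bₙ`, so telescoping makes `E d_Z²`
    -- summable, hence null.
    have hdsum : Summable fun n => (1 - χ) * ∫ ω, Metric.infDist (x n ω) Z ^ 2 ∂P :=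
      summable_of_succ_add_le (V := fun n => ∫ ω, Metric.infDist (x n ω) Z ^ 2 ∂P)
        (fun n => integral_nonneg fun ω => sq_nonneg _)
        (fun n => mul_nonneg (sub_nonneg.2 hχ1.le) (integral_nonneg fun ω => sq_nonneg _))
        (fun n => mul_nonneg zero_le_two (hx.integral_eps_mul_nonneg n 0)) (hε0.mul_left 2)
        fun n => by linarith [hsucc n]
    have hdlim : Tendsto (fun n => ∫ ω, Metric.infDist (x n ω) Z ^ 2 ∂P) atTop (𝓝 0) :=
      ((summable_mul_left_iff (sub_pos.2 hχ1).ne').1 hdsum).tendsto_atTop_zero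
    refine ⟨fun n => ?_, ?_⟩
    · refine (hbound (n + 1)).trans_eq ?_
      congr 2
      refine Finset.sum_congr rfl fun j _ => ?_
      congr 2
      omega
    · obtain ⟨y, hy, hyL2, hyAS⟩ := hx.exists_strongTendsto_of_frequently_infDist hZne hZcl hconv
        hc hε fun δ hδ => (hdlim.eventually (gt_mem_nhds hδ)).frequently
      refine ⟨y, ⟨hy.1, hyL2.2.1, Eventually.of_forall hy.2⟩, hyL2, hyAS, fun n => ?_⟩
      -- Fatou as `k → ∞` with `n` fixed turns the bound on `E‖x (n + k) - x n‖²` into one on `E‖y -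
      -- x n‖²`.
      have hlim : WeakTendstoAS P (fun k ω => x (n + k) ω - x n ω) (fun ω => y ω - x n ω) :=
        hyAS.mono fun ω hω => by
          have h1 : Tendsto (fun k => x (n + k) ω) atTop (𝓝 (y ω)) := by
            simpa only [add_comm n] using (tendsto_add_atTop_iff_nat n).2 hω
          exact (h1.sub_const (x n ω)).weakTendsto
      have hF := (memLp_and_integral_norm_sq_le_of_weakTendstoAS
        (fun k => (hx.memLp_x (n + k)).sub (hx.memLp_x n)) (hyL2.2.1.sub (hx.memLp_x n)).1
        (hx.integral_norm_sub_sq_le_infDist hZne hZcl hconv hc hε0 n) hlim).2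
      have hrev : ∫ ω, ‖x n ω - y ω‖ ^ 2 ∂P = ∫ ω, ‖(y - x n) ω‖ ^ 2 ∂P := by
        congr 1 with ω
        rw [Pi.sub_apply, norm_sub_rev]
      have hb := hbound n
      linarith
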